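/- **Setting.** There are $k$ bidders in a single-item auction, with independent valuations drawn from distributions $F_1,\dots,F_k$. A valuation distribution $F$ has a density $f$ that is positive on its support $[a,b]$, where $0\le a<\infty$, $a\le b\le\infty$; for $\alpha\in[0,1]$ it is *$\alpha$-strongly regular* if its virtual valuation $\varphi(v)=v-\frac{1-F(v)}{f(v)}$ satisfies $\varphi(y)-\varphi(x)\ge\alpha(y-x)$ for all $x<y$ in the support. (So $\alpha=0$ is regularity and $\alpha=1$ is the monotone hazard rate condition.) An *auction* is a (possibly randomized) truthful, i.e. dominant-strategy incentive compatible, and individually rational single-item auction with nonnegative payments. An *$m$-sample auction strategy* is a function from $m$ sample valuation profiles to auctions. Its expected revenue is taken over $m+1$ i.i.d. draws from $F_1\times\cdots\times F_k$: the $m$ samples, and the input on which the chosen auction is run. The revenue of an optimal auction for $F_1,\dots,F_k$ is the supremum of the expected revenues of all auctions. **Theorem (lower bound).** There are an absolute constant $N_0\in\mathbb N$ and, for every $k$, a number $\varepsilon_0(k)>0$ such that the following holds. Let $k\ge 2$, let $\varepsilon>0$, $\alpha\in[0,1]$ and let $m\ge 0$ be an integer, where $\varepsilon$ is sufficiently small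 in the sense that $\varepsilon\le\varepsilon_0(k)$ or $m\ge N_0k$. Suppose that one of the following holds: 1. $\alpha=1$ and $m\le\left(\dfrac{1-\ln 2}{96e^3\,\min\{1,\frac ke\}\,\ln\max\{e,k\}}\right)^{1/2}\dfrac{k}{\sqrt\varepsilon}$; 2. $0<\alpha<1$, $\alpha^{1/(1-\alpha)}\ge\frac1k$ and $m\le\left(\dfrac{1-\alpha2^{1-\alpha}}{96e^3}\right)^{1/(1+\alpha)}\dfrac{k}{\varepsilon^{1/(1+\alpha)}}$; 3. $0<\alpha<1$, $\frac1{2m}<\alpha^{1/(1-\alpha)}<\frac1k$ and $m\le\left(\dfrac{1-\alpha2^{1-\alpha}}{96e^3}\right)^{1/(1+\alpha)}\left(\dfrac1{k\,\alpha^{1/(1-\alpha)}}\right)^{\alpha/(1+\alpha)}\dfrac{k}{\varepsilon^{1/(1+\alpha)}}$; 4. $0<\alpha<1$, $\alpha^{1/(1-\alpha)}\le\frac1{2m}$ and $m\le\dfrac{(1-\alpha2^{1-\alpha})2^\alpha}{96e^3}\,\dfrac k\varepsilon$; 5. $\alpha=0$ and $m\le\dfrac1{96e^3}\,\dfrac k\varepsilon$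 (with $\frac1{2m}=\infty$ for $m=0$). Then for every $m$-sample auction strategy $\Sigma$ there are $\alpha$-strongly regular distributions $F_1,\dots,F_k$ such that the expected revenue of $\Sigma$ is less than $(1-\varepsilon)$ times the revenue of an optimal auction for $F_1,\dots,F_k$. -/

import Mathlib

open MeasureTheory ProbabilityTheory

/-- `μ` is an `α`-strongly regular valuation distribution: a probability distribution on the line
with support `[a, b]`, where `0 ≤ a < ∞` and `a ≤ b ≤ ∞`, having a density `f` that is positive on
`[a, b]`, whose virtual valuation `φ v = v - (1 - F v) / f v` (`F` is the distribution function)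
satisfies `φ y - φ x ≥ α (y - x)` for all points `x < y` of the support. -/
def IsStronglyRegular (α : ℝ) (μ : Measure ℝ) : Prop :=
  IsProbabilityMeasure μ ∧
    ∃ (a : ℝ) (b : EReal) (f : ℝ → ℝ),
      0 ≤ a ∧ (a : EReal) ≤ b ∧ Measurable f ∧
      (∀ v : ℝ, a ≤ v → (v : EReal) ≤ b → 0 < f v) ∧
      μ = volume.withDensity
        ({v : ℝ | a ≤ v ∧ (v : EReal) ≤ b}.indicator fun v => ENNReal.ofReal (f v)) ∧
      ∀ x y : ℝ, a ≤ x → x < y → (y : EReal) ≤ b →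
        α * (y - x) ≤ (y - (1 - cdf μ y) / f y) - (x - (1 - cdf μ x) / f x)

/-- A (possibly randomized) truthful single-item auction with `k` bidders. On the bid vector `b`,
bidder `i` receives the item with probability `alloc b i` and makes the expected payment `pay b i`.
Truthful bidding is a dominant strategy, participation is individually rational and payments are
nonnegative (equivalently, given truthfulness: a bid of `0` is charged `0`). The constraints are
imposed on nonnegative bids, the only ones that occur. -/
structure Auction (k : ℕ) where
  alloc : (Fin k → ℝ) → Fin k → ℝ
  pay : (Fin k → ℝ) → Fin k → ℝ
  measurable_alloc : Measurable alloc
  measurable_pay : Measurable pay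
  alloc_nonneg : ∀ b : Fin k → ℝ, (∀ j, 0 ≤ b j) → ∀ i, 0 ≤ alloc b i
  sum_alloc_le_one : ∀ b : Fin k → ℝ, (∀ j, 0 ≤ b j) → ∑ i, alloc b i ≤ 1
  truthful : ∀ b : Fin k → ℝ, (∀ j, 0 ≤ b j) → ∀ (i : Fin k) (t : ℝ), 0 ≤ t →
    b i * alloc (Function.update b i t) i - pay (Function.update b i t) i
      ≤ b i * alloc b i - pay b i
  individually_rational : ∀ b : Fin k → ℝ, (∀ j, 0 ≤ b j) → ∀ i, pay b i ≤ b i * alloc b i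
  pay_nonneg : ∀ b : Fin k → ℝ, (∀ j, 0 ≤ b j) → ∀ i, 0 ≤ pay b i

/-- The revenue of the auction `A` on the bid vector `b`. -/
noncomputable def Auction.revenue {k : ℕ} (A : Auction k) (b : Fin k → ℝ) : ENNReal :=
  ENNReal.ofReal (∑ i, A.pay b i)

/-- The expected revenue of the auction `A` when the valuations of the bidders are independent
with distributions `F 0, …, F (k - 1)`. -/
noncomputable def Auction.expectedRevenue {k : ℕ} (A : Auction k) (F : Fin k → Measure ℝ) :
    ENNReal :=
  ∫⁻ v, A.revenue v ∂(Measure.pi F)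

/-- The revenue of an optimal auction for `F 0, …, F (k - 1)`. -/
noncomputable def optimalRevenue {k : ℕ} (F : Fin k → Measure ℝ) : ENNReal :=
  ⨆ A : Auction k, A.expectedRevenue F

/-- An `m`-sample auction strategy for `k` bidders: a function from `m` sample valuation profiles
(`s j i` is the valuation of bidder `i` in the `j`-th sample) to auctions, jointly measurable in
the samples and the bids. -/
structure AuctionStrategy (k m : ℕ) where
  auction : (Fin m → Fin k → ℝ) → Auction k
  measurable_alloc : Measurable fun z : (Fin m → Fin k → ℝ) × (Fin k → ℝ) =>
    (auction z.1).alloc z.2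
  measurable_pay : Measurable fun z : (Fin m → Fin k → ℝ) × (Fin k → ℝ) =>
    (auction z.1).pay z.2

/-- The expected revenue of an `m`-sample auction strategy, over the `m` samples and the input,
which are `m + 1` independent draws from the product distribution `F 0 × ⋯ × F (k - 1)`. -/
noncomputable def AuctionStrategy.expectedRevenue {k m : ℕ} (S : AuctionStrategy k m)
    (F : Fin k → Measure ℝ) : ENNReal :=
  ∫⁻ z, (S.auction z.1).revenue z.2
    ∂((Measure.pi fun _ : Fin m => Measure.pi F).prod (Measure.pi F))

/-!
A strategy with too few samples cannot tell apart two distributions which agree except in a top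
piece of probability `p` of the order `1 / m`, and this costs it revenue.

Bidder `0` has a valuation that is nearly constant. The distribution of every other bidder has a
tail with `1 / hazard = 1 + β v`, whose virtual valuation has slope `1 - β ≥ α`, up to the quantile
`p`, reached at the valuation `t`; there the length scale is `s = 1 + β t`. The remaining mass `p`
is uniform on `[t, t + w]`, with `w = s` or `w = s / 3`. On a window above `t` the virtual
valuation `2 v - t - w` of such a bidder is below that of bidder `0` for `w = s` and above it for
`w = s / 3`, by amounts of the order `s`, while the two densities have the ratio `1 : 3`. If no
sample of the bidder reaches `t` and the input of the bidder lies in the window, every allocation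
therefore loses virtual surplus of the order `s` under one of the two hypotheses
(`LinearHazardTail.shortfall_pair`). Formally, on this confusion event the joint laws of samples
and input are proportional (`LinearHazardTail.law_restrict_confusion`).

By Myerson's lemma (`Auction.sum_integral_pay_le`, from the envelope formula
`integral_allocation_eq_utility_sub`) the revenue of an auction is at most its expected virtual
surplus, and the pointwise maximal virtual surplus is attained by an auction
(`integral_maxSurplus_le_optimalRevenue`). So the expected shortfall of virtual surplus bounds the
revenue loss from below. The confusion events of different bidders are disjoint; averaging over all
choices of the widths gives a profile with a loss of the order `k p s`
(`LinearHazardTail.exists_lt_loss`), whereas the optimal revenue is at most `t + s`.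

The relative loss is thus of the order `(k / m) * s / (t + s)`. For `α < 1` the last factor is at
least `(1 - α) / 2`, and every sample bound of the theorem for `α < 1` implies that
`ε ≤ (1 - α) / (96 e ^ 3) * k / m`, which is smaller. For `α = 1` the factor is
`1 / (1 + log (2 m))`, and the sample bound is of the order `ε ≤ (k / m) ^ 2 / log k`, where one
factor `k / m` absorbs the difference of the logarithms. If `m < 10 k`, the exponential tail, which
is strongly regular for every `α ≤ 1`, is cut at a quantile that depends only on `k`.
-/

/-! ### Valuation distributions with bounded support -/

/-- A valuation distribution with bounded support `[lo, hi]`, given by its density and its tail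
function `v ↦ P(V > v)`, with monotone virtual valuation. The density is minus the right derivative
of the tail, so that it may jump inside the support. -/
structure BoundedValuation where
  lo : ℝ
  hi : ℝ
  density : ℝ → ℝ
  tail : ℝ → ℝ
  lo_nonneg : 0 ≤ lo
  lo_lt_hi : lo < hi
  measurable_density : Measurable density
  measurable_tail : Measurable tail
  density_pos : ∀ v ∈ Set.Icc lo hi, 0 < density v
  continuousOn_tail : ContinuousOn tail (Set.Icc lo hi)
  hasDerivWithinAt_tail :
    ∀ v ∈ Set.Ioo lo hi, HasDerivWithinAt tail (-density v) (Set.Ioi v) v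
  tail_lo : tail lo = 1
  tail_hi : tail hi = 0
  virtual_monotoneOn : MonotoneOn (fun v => v - tail v / density v) (Set.Icc lo hi)

namespace BoundedValuation

variable (D : BoundedValuation)

/-- The virtual valuation `φ v = v - (1 - F v) / f v`. -/
noncomputable def virtual (v : ℝ) : ℝ := v - D.tail v / D.density v

/-- The probability measure of a bounded valuation distribution. -/
noncomputable def measure : Measure ℝ :=
  volume.withDensity ((Set.Icc D.lo D.hi).indicator fun v => ENNReal.ofReal (D.density v))

lemma measurable_virtual : Measurable D.virtual :=
  measurable_id.sub (D.measurable_tail.div D.measurable_density)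

lemma integrableOn_density : IntegrableOn D.density (Set.Icc D.lo D.hi) := by
  rw [integrableOn_Icc_iff_integrableOn_Ioc]
  refine intervalIntegral.integrableOn_deriv_right_of_nonneg (g := -D.tail)
    D.continuousOn_tail.neg (fun x hx => ?_)
    (fun x hx => (D.density_pos x (Set.Ioo_subset_Icc_self hx)).le)
  simpa using (D.hasDerivWithinAt_tail x hx).neg

lemma intervalIntegral_density {x y : ℝ} (hx : D.lo ≤ x) (hxy : x ≤ y) (hy : y ≤ D.hi) :
    ∫ v in x..y, D.density v = D.tail x - D.tail y := by
  have hsub : Set.Icc x y ⊆ Set.Icc D.lo D.hi := Set.Icc_subset_Icc hx hy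
  have h := intervalIntegral.integral_eq_sub_of_hasDeriv_right_of_le (f := -D.tail)
    (f' := D.density) hxy (D.continuousOn_tail.neg.mono hsub)
    (fun v hv => by
      simpa using (D.hasDerivWithinAt_tail v ⟨hx.trans_lt hv.1, hv.2.trans_le hy⟩).neg)
    ((intervalIntegrable_iff_integrableOn_Icc_of_le hxy).2 (D.integrableOn_density.mono_set hsub))
  rw [h]; simp only [Pi.neg_apply]; ring

lemma measure_Icc {x y : ℝ} (hx : D.lo ≤ x) (hxy : x ≤ y) (hy : y ≤ D.hi) :
    D.measure (Set.Icc x y) = ENNReal.ofReal (D.tail x - D.tail y) := by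
  have hsub : Set.Icc x y ⊆ Set.Icc D.lo D.hi := Set.Icc_subset_Icc hx hy
  rw [measure, withDensity_apply _ measurableSet_Icc, setLIntegral_indicator measurableSet_Icc,
    Set.inter_eq_right.2 hsub, ← D.intervalIntegral_density hx hxy hy,
    intervalIntegral.integral_of_le hxy, ← integral_Icc_eq_integral_Ioc,
    ofReal_integral_eq_lintegral_ofReal]
  · exact D.integrableOn_density.mono_set hsub
  · exact (ae_restrict_iff' measurableSet_Icc).2
      (Filter.Eventually.of_forall fun v hv => (D.density_pos v (hsub hv)).le)

lemma measure_compl_Icc : D.measure (Set.Icc D.lo D.hi)ᶜ = 0 := by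
  rw [measure, withDensity_apply _ measurableSet_Icc.compl,
    setLIntegral_indicator measurableSet_Icc]
  simp

lemma ae_mem_Icc : ∀ᵐ v ∂D.measure, v ∈ Set.Icc D.lo D.hi := by
  rw [ae_iff]; exact D.measure_compl_Icc

lemma measure_inter_Icc (s : Set ℝ) : D.measure (s ∩ Set.Icc D.lo D.hi) = D.measure s :=
  measure_inter_conull D.measure_compl_Icc

instance : IsProbabilityMeasure D.measure := by
  constructor
  rw [← D.measure_inter_Icc, Set.univ_inter, D.measure_Icc le_rfl D.lo_lt_hi.le le_rfl, D.tail_lo,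
    D.tail_hi]
  simp

lemma measure_Ici {r : ℝ} (hr : r ∈ Set.Icc D.lo D.hi) :
    D.measure (Set.Ici r) = ENNReal.ofReal (D.tail r) := by
  rw [← D.measure_inter_Icc]
  have : Set.Ici r ∩ Set.Icc D.lo D.hi = Set.Icc r D.hi := by
    ext v; simp only [Set.mem_inter_iff, Set.mem_Ici, Set.mem_Icc]
    exact ⟨fun h => ⟨h.1, h.2.2⟩, fun h => ⟨h.1, hr.1.trans h.1, h.2⟩⟩
  rw [this, D.measure_Icc hr.1 hr.2 le_rfl, D.tail_hi, sub_zero]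

instance : NullSingletonClass D.measure := by unfold measure; infer_instance

lemma tail_nonneg {r : ℝ} (hr : r ∈ Set.Icc D.lo D.hi) : 0 ≤ D.tail r := by
  have h := D.intervalIntegral_density hr.1 hr.2 le_rfl
  rw [D.tail_hi, sub_zero] at h
  rw [← h]
  exact intervalIntegral.integral_nonneg hr.2
    fun v hv => (D.density_pos v ⟨hr.1.trans hv.1, hv.2⟩).le

lemma one_sub_cdf {r : ℝ} (hr : r ∈ Set.Icc D.lo D.hi) : 1 - cdf D.measure r = D.tail r := by
  rw [cdf_eq_real, ← probReal_compl_eq_one_sub measurableSet_Iic, Set.compl_Iic, measureReal_def,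
    measure_congr Ioi_ae_eq_Ici, D.measure_Ici hr, ENNReal.toReal_ofReal (D.tail_nonneg hr)]

lemma virtual_le {r : ℝ} (hr : r ∈ Set.Icc D.lo D.hi) : D.virtual r ≤ r :=
  sub_le_self _ (div_nonneg (D.tail_nonneg hr) (D.density_pos r hr).le)

lemma isStronglyRegular {α : ℝ} (h : ∀ x ∈ Set.Icc D.lo D.hi, ∀ y ∈ Set.Icc D.lo D.hi, x < y →
    α * (y - x) ≤ D.virtual y - D.virtual x) : IsStronglyRegular α D.measure := by
  refine ⟨inferInstance, D.lo, (D.hi : EReal), D.density, D.lo_nonneg,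
    EReal.coe_le_coe_iff.2 D.lo_lt_hi.le, D.measurable_density,
    fun v h1 h2 => D.density_pos v ⟨h1, EReal.coe_le_coe_iff.1 h2⟩, ?_, ?_⟩
  · have : {v : ℝ | D.lo ≤ v ∧ (v : EReal) ≤ (D.hi : EReal)} = Set.Icc D.lo D.hi := by
      ext v; simp [EReal.coe_le_coe_iff]
    rw [this]; rfl
  · intro x y hx hxy hy
    have hy' := EReal.coe_le_coe_iff.1 hy
    have hxm : x ∈ Set.Icc D.lo D.hi := ⟨hx, hxy.le.trans hy'⟩
    have hym : y ∈ Set.Icc D.lo D.hi := ⟨hx.trans hxy.le, hy'⟩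
    rw [D.one_sub_cdf hxm, D.one_sub_cdf hym]
    exact h x hxm y hym hxy

end BoundedValuation

/-! ### Truthful payments for a single bidder -/

/-- The envelope formula: the utility `u` of a truthful bidder with interim allocation `x` has
derivative `x`. -/
lemma integral_allocation_eq_utility_sub {x u : ℝ → ℝ}
    (h : ∀ r, 0 ≤ r → ∀ s, 0 ≤ s → u r + (s - r) * x r ≤ u s)
    (hx1 : ∀ r, 0 ≤ r → |x r| ≤ 1) {a s : ℝ} (ha : 0 ≤ a) (has : a ≤ s) :
    ∫ r in a..s, x r = u s - u a := by
  have hmono : MonotoneOn x (Set.Ici 0) := by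
    intro r hr s hs hrs
    rcases hrs.eq_or_lt with rfl | hlt
    · exact le_rfl
    · have h1 := h r hr s hs
      have h2 := h s hs r hr
      by_contra hc
      push Not at hc
      nlinarith [mul_pos (sub_pos.2 hlt) (sub_pos.2 hc)]
  have hlip : ∀ r, 0 ≤ r → ∀ s, 0 ≤ s → u r - u s ≤ |r - s| := by
    intro r hr s hs
    have h1 := h r hr s hs
    have h2 : |(r - s) * x r| ≤ |r - s| := by
      rw [abs_mul]; exact mul_le_of_le_one_right (abs_nonneg _) (hx1 r hr)
    have h3 := le_abs_self ((r - s) * x r)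
    linarith
  have hcont : ContinuousOn u (Set.Icc a s) := by
    have : LipschitzOnWith 1 u (Set.Icc a s) := by
      refine LipschitzOnWith.of_dist_le_mul fun r hr s hs => ?_
      have := hlip r (ha.trans hr.1) s (ha.trans hs.1)
      have := hlip s (ha.trans hs.1) r (ha.trans hr.1)
      rw [Real.dist_eq, Real.dist_eq, NNReal.coe_one, one_mul, abs_le]
      rw [abs_sub_comm s r] at this
      constructor <;> linarith
    exact this.continuousOn
  have hcount := hmono.countable_not_continuousWithinAt
  refine MeasureTheory.integral_eq_of_hasDerivAt_off_countable_of_le u x has hcount hcont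
    (fun r hr => ?_) ?_
  · have hr0 : 0 < r := ha.trans_lt hr.1.1
    have hc : ContinuousAt x r := by
      have : ContinuousWithinAt x (Set.Ici 0) r := by
        by_contra hcon
        exact hr.2 ⟨hr0.le, hcon⟩
      exact this.continuousAt (Ici_mem_nhds hr0)
    -- The difference quotient of `u` lies between the values of `x` at its two end points.
    rw [hasDerivAt_iff_isLittleO, Asymptotics.isLittleO_iff]
    intro c hcpos
    filter_upwards [Metric.continuousAt_iff'.1 hc c hcpos, Ioi_mem_nhds hr0] with y hy hy0
    have h1 := h r hr0.le y (le_of_lt hy0)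
    have h2 := h y (le_of_lt hy0) r hr0.le
    rw [Real.dist_eq] at hy
    have h3 : |(y - r) * (x y - x r)| ≤ c * |y - r| := by
      rw [abs_mul, mul_comm]; exact mul_le_mul_of_nonneg_right hy.le (abs_nonneg _)
    have h4 := le_abs_self ((y - r) * (x y - x r))
    rw [Real.norm_eq_abs, Real.norm_eq_abs, smul_eq_mul, abs_of_nonneg] <;> linarith
  · refine MonotoneOn.intervalIntegrable (hmono.mono fun r hr => ?_)
    rw [Set.uIcc_of_le has] at hr
    exact ha.trans hr.1

namespace BoundedValuation

variable (D : BoundedValuation)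

lemma measure_eq_withDensity_restrict :
    D.measure = (volume.restrict (Set.Icc D.lo D.hi)).withDensity
      fun v => ENNReal.ofReal (D.density v) := by
  rw [measure, withDensity_indicator measurableSet_Icc]

lemma virtual_mem_Icc {v : ℝ} (hv : v ∈ Set.Icc D.lo D.hi) :
    D.virtual v ∈ Set.Icc (D.virtual D.lo) (D.virtual D.hi) :=
  ⟨D.virtual_monotoneOn ⟨le_rfl, D.lo_lt_hi.le⟩ hv hv.1,
    D.virtual_monotoneOn hv ⟨D.lo_lt_hi.le, le_rfl⟩ hv.2⟩

lemma abs_virtual_le {v : ℝ} (hv : v ∈ Set.Icc D.lo D.hi) :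
    |D.virtual v| ≤ |D.virtual D.lo| + |D.virtual D.hi| := by
  have h := D.virtual_mem_Icc hv
  have h1 := neg_abs_le (D.virtual D.lo)
  have h2 := le_abs_self (D.virtual D.hi)
  have h3 := abs_nonneg (D.virtual D.lo)
  have h4 := abs_nonneg (D.virtual D.hi)
  rw [abs_le]
  constructor <;> linarith [h.1, h.2]

/-- Myerson's lemma for one bidder: the envelope payments raise the virtual surplus. -/
lemma integral_envelope_payment {x : ℝ → ℝ} (hx : Measurable x)
    (h0 : ∀ r, 0 ≤ r → 0 ≤ x r) (h1 : ∀ r, 0 ≤ r → x r ≤ 1) :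
    Integrable (fun s => s * x s - ∫ r in D.lo..s, x r) D.measure ∧
    Integrable (fun s => D.virtual s * x s) D.measure ∧
    ∫ s, (s * x s - ∫ r in D.lo..s, x r) ∂D.measure = ∫ s, D.virtual s * x s ∂D.measure := by
  set μ := D.measure with hμ
  set ν := (volume : Measure ℝ).restrict (Set.Icc D.lo D.hi) with hν
  have hxabs : ∀ r ∈ Set.Icc D.lo D.hi, |x r| ≤ 1 := fun r hr => by
    have hr0 := D.lo_nonneg.trans hr.1
    rw [abs_of_nonneg (h0 r hr0)]; exact h1 r hr0
  have hνae : ∀ᵐ r ∂ν, r ∈ Set.Icc D.lo D.hi := ae_restrict_mem measurableSet_Icc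
  -- Fubini for the kernel `1_{r ≤ s} x r`, whose integral over `s` is `x r` times the tail.
  let K : ℝ → ℝ → ℝ := fun s r => (Set.Iic s).indicator x r
  have hKm : Measurable (Function.uncurry K) := by
    have : Function.uncurry K = {z : ℝ × ℝ | z.2 ≤ z.1}.indicator fun z => x z.2 := by
      ext z; rfl
    rw [this]
    exact (hx.comp measurable_snd).indicator (measurableSet_le measurable_snd measurable_fst)
  have hKint : Integrable (Function.uncurry K) (μ.prod ν) := by
    refine Integrable.of_bound hKm.aestronglyMeasurable 1 ?_
    filter_upwards [Measure.quasiMeasurePreserving_snd.ae hνae] with z hz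
    refine le_trans ?_ (hxabs z.2 hz)
    exact norm_indicator_le_norm_self x z.2
  have hinner : (fun s => ∫ r, K s r ∂ν) =ᵐ[μ] fun s => ∫ r in D.lo..s, x r := by
    filter_upwards [D.ae_mem_Icc] with s hs
    have hset : Set.Iic s ∩ Set.Icc D.lo D.hi = Set.Icc D.lo s := by
      ext v; simp only [Set.mem_inter_iff, Set.mem_Iic, Set.mem_Icc]
      exact ⟨fun h => ⟨h.2.1, h.1⟩, fun h => ⟨h.2, h.1, h.2.trans hs.2⟩⟩
    simp only [K]
    rw [integral_indicator measurableSet_Iic, hν, Measure.restrict_restrict measurableSet_Iic, hset,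
      intervalIntegral.integral_of_le hs.1, integral_Icc_eq_integral_Ioc]
  have hswap : ∫ s, (∫ r in D.lo..s, x r) ∂μ = ∫ r, x r * (D.tail r / D.density r) ∂μ := by
    rw [← integral_congr_ae hinner, integral_integral_swap hKint, hμ,
      D.measure_eq_withDensity_restrict, integral_withDensity_eq_integral_toReal_smul
        D.measurable_density.ennreal_ofReal
        (Filter.Eventually.of_forall fun _ => ENNReal.ofReal_lt_top)]
    refine integral_congr_ae ?_
    filter_upwards [hνae] with r hr
    have hd := D.density_pos r hr
    have : (fun s => K s r) = (Set.Ici r).indicator fun _ => x r := by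
      ext s; simp [K, Set.indicator_apply]
    rw [← D.measure_eq_withDensity_restrict, this, integral_indicator measurableSet_Ici,
      setIntegral_const, measureReal_def, D.measure_Ici hr,
      ENNReal.toReal_ofReal (D.tail_nonneg hr), ENNReal.toReal_ofReal hd.le, smul_eq_mul,
      smul_eq_mul]
    field_simp
  have hint_sx : Integrable (fun s => s * x s) μ := by
    refine Integrable.of_bound (measurable_id.mul hx).aestronglyMeasurable D.hi ?_
    filter_upwards [D.ae_mem_Icc] with s hs
    have hs0 := D.lo_nonneg.trans hs.1
    rw [Real.norm_eq_abs, abs_mul, abs_of_nonneg hs0]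
    exact (mul_le_of_le_one_right hs0 (hxabs s hs)).trans hs.2
  have hint_vx : Integrable (fun s => D.virtual s * x s) μ := by
    refine Integrable.of_bound (D.measurable_virtual.mul hx).aestronglyMeasurable
      (|D.virtual D.lo| + |D.virtual D.hi|) ?_
    filter_upwards [D.ae_mem_Icc] with s hs
    rw [Real.norm_eq_abs, abs_mul]
    exact (mul_le_of_le_one_right (abs_nonneg _) (hxabs s hs)).trans (D.abs_virtual_le hs)
  have hint_in : Integrable (fun s => ∫ r in D.lo..s, x r) μ :=
    hKint.integral_prod_left.congr hinner
  refine ⟨hint_sx.sub hint_in, hint_vx, ?_⟩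
  rw [integral_sub hint_sx hint_in, hswap, sub_eq_iff_eq_add, ← integral_add hint_vx]
  · refine integral_congr_ae (Filter.Eventually.of_forall fun s => ?_)
    simp only [virtual]; ring
  · refine (hint_sx.sub hint_vx).congr (Filter.Eventually.of_forall fun s => ?_)
    simp only [virtual, Pi.sub_apply]; ring

end BoundedValuation

/-! ### Revenue and virtual surplus of auctions -/

/-- Resampling one coordinate does not change a product distribution. -/
lemma measurePreserving_update {ι : Type*} [Fintype ι] [DecidableEq ι] (F : ι → Measure ℝ)
    [∀ i, IsProbabilityMeasure (F i)] (i : ι) :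
    MeasurePreserving (fun z : (ι → ℝ) × ℝ => Function.update z.1 i z.2)
      ((Measure.pi F).prod (F i)) (Measure.pi F) := by
  have hm : Measurable fun z : (ι → ℝ) × ℝ => Function.update z.1 i z.2 := measurable_update'
  refine ⟨hm, (Measure.pi_eq fun s hs => ?_).symm⟩
  rw [Measure.map_apply hm (MeasurableSet.univ_pi hs)]
  have : (fun z : (ι → ℝ) × ℝ => Function.update z.1 i z.2) ⁻¹' Set.univ.pi s =
      (Set.univ.pi (Function.update s i Set.univ)) ×ˢ s i := by
    ext z
    simp only [Set.mem_preimage, Set.mem_pi, Set.mem_univ, forall_const, Set.mem_prod]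
    constructor
    · intro h
      refine ⟨fun j => ?_, by simpa using h i⟩
      by_cases hj : j = i
      · subst hj; simp
      · simpa [hj] using h j
    · intro h j
      by_cases hj : j = i
      · subst hj; simpa using h.2
      · simpa [hj] using h.1 j
  rw [this, Measure.prod_prod, Measure.pi_pi, ← Finset.prod_erase_mul _ _ (Finset.mem_univ i),
    ← Finset.prod_erase_mul Finset.univ (fun j => F j (s j)) (Finset.mem_univ i)]
  congr 1
  rw [Function.update_self, measure_univ, mul_one]
  refine Finset.prod_congr rfl fun j hj => ?_
  rw [Function.update_of_ne (Finset.ne_of_mem_erase hj)]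

lemma measurable_intervalIntegral_update {ι : Type*} [Fintype ι] [DecidableEq ι]
    {x : (ι → ℝ) → ℝ} (hx : Measurable x) (i : ι) (a : ℝ) :
    Measurable fun v : ι → ℝ => ∫ r in a..v i, x (Function.update v i r) := by
  have hm : Measurable fun z : (ι → ℝ) × ℝ => x (Function.update z.1 i z.2) :=
    hx.comp measurable_update'
  have key : ∀ S : Set ((ι → ℝ) × ℝ), MeasurableSet S →
      Measurable fun v : ι → ℝ =>
        ∫ r, S.indicator (fun z => x (Function.update z.1 i z.2)) (v, r) :=
    fun S hS => (StronglyMeasurable.integral_prod_right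
      (f := fun v r => S.indicator (fun z => x (Function.update z.1 i z.2)) (v, r))
      (hm.indicator hS).stronglyMeasurable).measurable
  have h1 : MeasurableSet {z : (ι → ℝ) × ℝ | a < z.2 ∧ z.2 ≤ z.1 i} :=
    (measurableSet_lt measurable_const measurable_snd).inter
      (measurableSet_le measurable_snd ((measurable_pi_apply i).comp measurable_fst))
  have h2 : MeasurableSet {z : (ι → ℝ) × ℝ | z.1 i < z.2 ∧ z.2 ≤ a} :=
    (measurableSet_lt ((measurable_pi_apply i).comp measurable_fst) measurable_snd).inter
      (measurableSet_le measurable_snd measurable_const)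
  convert (key _ h1).sub (key _ h2) using 1
  ext v
  simp only [intervalIntegral, Pi.sub_apply, ← integral_indicator measurableSet_Ioc]
  rfl

section VirtualSurplus

variable {k : ℕ} (D : Fin k → BoundedValuation)

lemma ae_forall_mem_Icc :
    ∀ᵐ v ∂Measure.pi fun i => (D i).measure, ∀ i, v i ∈ Set.Icc (D i).lo (D i).hi := by
  rw [ae_all_iff]
  exact fun i => (measurePreserving_eval (fun i => (D i).measure) i).quasiMeasurePreserving.ae
    (D i).ae_mem_Icc

/-- Myerson's lemma for one bidder of many: the envelope payments of bidder `i` raise the virtual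
surplus of `i`. -/
lemma integral_pi_envelope_payment (i : Fin k) {x : (Fin k → ℝ) → ℝ} (hx : Measurable x)
    (h0 : ∀ b : Fin k → ℝ, (∀ j, 0 ≤ b j) → 0 ≤ x b)
    (h1 : ∀ b : Fin k → ℝ, (∀ j, 0 ≤ b j) → x b ≤ 1) :
    Integrable (fun v => v i * x v - ∫ r in (D i).lo..v i, x (Function.update v i r))
      (Measure.pi fun i => (D i).measure) ∧
    Integrable (fun v => (D i).virtual (v i) * x v) (Measure.pi fun i => (D i).measure) ∧
    ∫ v, (v i * x v - ∫ r in (D i).lo..v i, x (Function.update v i r))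
        ∂(Measure.pi fun i => (D i).measure) =
      ∫ v, (D i).virtual (v i) * x v ∂(Measure.pi fun i => (D i).measure) := by
  set F : Fin k → Measure ℝ := fun i => (D i).measure with hF
  have hsupp := ae_forall_mem_Icc D
  have hxabs : ∀ b : Fin k → ℝ, (∀ j, 0 ≤ b j) → |x b| ≤ 1 := fun b hb => by
    rw [abs_of_nonneg (h0 b hb)]; exact h1 b hb
  have hint1 : Integrable
      (fun v => v i * x v - ∫ r in (D i).lo..v i, x (Function.update v i r)) (Measure.pi F) := by
    refine Integrable.of_bound (((measurable_pi_apply i).mul hx).sub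
      (measurable_intervalIntegral_update hx i _)).aestronglyMeasurable
      ((D i).hi + (D i).hi) ?_
    filter_upwards [hsupp] with v hv
    have hv0 : ∀ j, 0 ≤ v j := fun j => (D j).lo_nonneg.trans (hv j).1
    refine (norm_sub_le _ _).trans (add_le_add ?_ ?_)
    · rw [Real.norm_eq_abs, abs_mul, abs_of_nonneg (hv0 i)]
      exact (mul_le_of_le_one_right (hv0 i) (hxabs v hv0)).trans (hv i).2
    · refine (intervalIntegral.norm_integral_le_of_norm_le_const (C := 1) fun r hr => ?_).trans ?_
      · rw [Set.uIoc_of_le (hv i).1] at hr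
        refine hxabs _ fun j => ?_
        by_cases hj : j = i
        · subst hj; simpa using (D j).lo_nonneg.trans hr.1.le
        · simpa [hj] using hv0 j
      · rw [one_mul, abs_of_nonneg (sub_nonneg.2 (hv i).1)]
        linarith [(D i).lo_nonneg, (hv i).2]
  have hint2 : Integrable (fun v => (D i).virtual (v i) * x v) (Measure.pi F) := by
    refine Integrable.of_bound
      (((D i).measurable_virtual.comp (measurable_pi_apply i)).mul hx).aestronglyMeasurable
      (|(D i).virtual (D i).lo| + |(D i).virtual (D i).hi|) ?_
    filter_upwards [hsupp] with v hv
    rw [Real.norm_eq_abs, abs_mul]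
    exact (mul_le_of_le_one_right (abs_nonneg _)
      (hxabs v fun j => (D j).lo_nonneg.trans (hv j).1)).trans ((D i).abs_virtual_le (hv i))
  refine ⟨hint1, hint2, ?_⟩
  have hmp := measurePreserving_update F i
  -- Both integrals are computed by first resampling the valuation of bidder `i`.
  have hresample : ∀ g : (Fin k → ℝ) → ℝ, Integrable g (Measure.pi F) →
      ∫ v, g v ∂(Measure.pi F) =
        ∫ v, (∫ s, g (Function.update v i s) ∂(F i)) ∂(Measure.pi F) := by
    intro g hg
    have hg' : Integrable g (((Measure.pi F).prod (F i)).map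
        fun z : (Fin k → ℝ) × ℝ => Function.update z.1 i z.2) := by rwa [hmp.map_eq]
    rw [← integral_prod (fun z : (Fin k → ℝ) × ℝ => g (Function.update z.1 i z.2))
      (hg'.comp_measurable hmp.measurable)]
    conv_lhs => rw [← hmp.map_eq]
    exact integral_map hmp.measurable.aemeasurable hg'.aestronglyMeasurable
  rw [hresample _ hint1, hresample _ hint2]
  refine integral_congr_ae ?_
  filter_upwards [hsupp] with v hv
  have hnn : ∀ r, 0 ≤ r → ∀ j, 0 ≤ Function.update v i r j := by
    intro r hr j
    by_cases hj : j = i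
    · subst hj; simpa using hr
    · simpa [hj] using (D j).lo_nonneg.trans (hv j).1
  have := ((D i).integral_envelope_payment (x := fun r => x (Function.update v i r))
    (hx.comp (measurable_update v)) (fun r hr => h0 _ (hnn r hr))
    (fun r hr => h1 _ (hnn r hr))).2.2
  simpa using this

/-- The virtual surplus of the allocation `x` at the valuation profile `v`. -/
noncomputable def virtualSurplus (v x : Fin k → ℝ) : ℝ := ∑ i, (D i).virtual (v i) * x i

variable {D}

lemma Auction.alloc_le_one (A : Auction k) {b : Fin k → ℝ} (hb : ∀ j, 0 ≤ b j) (i : Fin k) :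
    A.alloc b i ≤ 1 :=
  (Finset.single_le_sum (fun j _ => A.alloc_nonneg b hb j) (Finset.mem_univ i)).trans
    (A.sum_alloc_le_one b hb)

/-- Truthfulness and individual rationality bound a payment by the envelope payment. -/
lemma Auction.pay_le_envelope (A : Auction k) {b : Fin k → ℝ} (hb : ∀ j, 0 ≤ b j) (i : Fin k)
    {a : ℝ} (ha : 0 ≤ a) (hab : a ≤ b i) :
    A.pay b i ≤ b i * A.alloc b i - ∫ r in a..b i, A.alloc (Function.update b i r) i := by
  have hnn : ∀ r, 0 ≤ r → ∀ j, 0 ≤ Function.update b i r j := by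
    intro r hr j
    by_cases hj : j = i
    · subst hj; simpa using hr
    · simpa [hj] using hb j
  have h := integral_allocation_eq_utility_sub
    (x := fun r => A.alloc (Function.update b i r) i)
    (u := fun r => r * A.alloc (Function.update b i r) i - A.pay (Function.update b i r) i)
    (fun r hr s hs => by
      have := A.truthful (Function.update b i s) (hnn s hs) i r hr
      simp only [Function.update_self, Function.update_idem] at this
      linarith)
    (fun r hr => by
      rw [abs_of_nonneg (A.alloc_nonneg _ (hnn r hr) i)]
      exact A.alloc_le_one (hnn r hr) i) ha hab
  have h2 := A.individually_rational _ (hnn a ha) i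
  simp only [Function.update_self] at h2
  simp only [Function.update_eq_self] at h
  linarith

variable (D)

lemma Auction.integrable_pay (A : Auction k) (i : Fin k) :
    Integrable (fun v => A.pay v i) (Measure.pi fun i => (D i).measure) := by
  refine Integrable.of_bound
    ((measurable_pi_apply i).comp A.measurable_pay).aestronglyMeasurable (D i).hi ?_
  filter_upwards [ae_forall_mem_Icc D] with v hv
  have hv0 : ∀ j, 0 ≤ v j := fun j => (D j).lo_nonneg.trans (hv j).1
  rw [Real.norm_eq_abs, abs_of_nonneg (A.pay_nonneg v hv0 i)]
  exact (A.individually_rational v hv0 i).trans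
    ((mul_le_of_le_one_right (hv0 i) (A.alloc_le_one hv0 i)).trans (hv i).2)

lemma Auction.expectedRevenue_eq (A : Auction k) :
    A.expectedRevenue (fun i => (D i).measure) =
      ENNReal.ofReal (∑ i, ∫ v, A.pay v i ∂(Measure.pi fun i => (D i).measure)) := by
  rw [← integral_finsetSum _ fun i _ => A.integrable_pay D i, ofReal_integral_eq_lintegral_ofReal
    (integrable_finsetSum _ fun i _ => A.integrable_pay D i)]
  · rfl
  · filter_upwards [ae_forall_mem_Icc D] with v hv
    exact Finset.sum_nonneg fun i _ =>
      A.pay_nonneg v (fun j => (D j).lo_nonneg.trans (hv j).1) i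

lemma integrable_virtualSurplus {x : (Fin k → ℝ) → Fin k → ℝ} (hx : Measurable x)
    (h0 : ∀ b : Fin k → ℝ, (∀ j, 0 ≤ b j) → ∀ i, 0 ≤ x b i)
    (h1 : ∀ b : Fin k → ℝ, (∀ j, 0 ≤ b j) → ∀ i, x b i ≤ 1) :
    Integrable (fun v => virtualSurplus D v (x v)) (Measure.pi fun i => (D i).measure) :=
  integrable_finsetSum _ fun i _ =>
    (integral_pi_envelope_payment D i ((measurable_pi_apply i).comp hx)
      (fun b hb => h0 b hb i) (fun b hb => h1 b hb i)).2.1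

/-- Myerson's bound: an auction earns at most its expected virtual surplus. -/
lemma Auction.sum_integral_pay_le (A : Auction k) :
    ∑ i, ∫ v, A.pay v i ∂(Measure.pi fun i => (D i).measure) ≤
      ∫ v, virtualSurplus D v (A.alloc v) ∂(Measure.pi fun i => (D i).measure) := by
  have key := fun i : Fin k => integral_pi_envelope_payment D i
    ((measurable_pi_apply i).comp A.measurable_alloc)
    (fun b hb => A.alloc_nonneg b hb i) (fun b hb => A.alloc_le_one hb i)
  simp only [Function.comp_def] at key
  unfold virtualSurplus
  rw [integral_finsetSum _ fun i _ => (key i).2.1]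
  refine Finset.sum_le_sum fun i _ => ?_
  refine le_trans ?_ (key i).2.2.le
  refine integral_mono_ae (A.integrable_pay D i) (key i).1 ?_
  filter_upwards [ae_forall_mem_Icc D] with v hv
  exact A.pay_le_envelope (fun j => (D j).lo_nonneg.trans (hv j).1) i (D i).lo_nonneg (hv i).1

end VirtualSurplus

/-! ### Auctions from monotone allocation rules -/

/-- The auction with a given monotone allocation rule and the envelope payments. -/
noncomputable def Auction.ofMonotone {k : ℕ} (x : (Fin k → ℝ) → Fin k → ℝ) (hx : Measurable x)
    (h0 : ∀ b i, 0 ≤ x b i) (h1 : ∀ b, ∑ i, x b i ≤ 1)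
    (hmono : ∀ b i, Monotone fun r => x (Function.update b i r) i) : Auction k where
  alloc := x
  pay b i := b i * x b i - ∫ r in (0 : ℝ)..b i, x (Function.update b i r) i
  measurable_alloc := hx
  measurable_pay := by
    refine measurable_pi_lambda _ fun i => Measurable.sub
      ((measurable_pi_apply i).mul ((measurable_pi_apply i).comp hx)) ?_
    exact measurable_intervalIntegral_update ((measurable_pi_apply i).comp hx) i 0
  alloc_nonneg b _ i := h0 b i
  sum_alloc_le_one b _ := h1 b
  truthful b _ i t _ := by
    simp only [Function.update_self, Function.update_idem]
    have hii : ∀ c d : ℝ, IntervalIntegrable (fun r => x (Function.update b i r) i) volume c d :=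
      fun c d => (hmono b i).intervalIntegrable
    have hadd := intervalIntegral.integral_add_adjacent_intervals (hii 0 t) (hii t (b i))
    have hle : (b i - t) * x (Function.update b i t) i ≤
        ∫ r in t..b i, x (Function.update b i r) i := by
      rcases le_total t (b i) with h | h
      · calc (b i - t) * x (Function.update b i t) i
            = ∫ _ in t..b i, x (Function.update b i t) i := by
              rw [intervalIntegral.integral_const, smul_eq_mul]
          _ ≤ _ := intervalIntegral.integral_mono_on h intervalIntegrable_const (hii _ _)
              fun r hr => hmono b i hr.1
      · have : ∫ r in b i..t, x (Function.update b i r) i ≤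
            ∫ _ in b i..t, x (Function.update b i t) i :=
          intervalIntegral.integral_mono_on h (hii _ _) intervalIntegrable_const
            fun r hr => hmono b i hr.2
        rw [intervalIntegral.integral_const, smul_eq_mul] at this
        rw [intervalIntegral.integral_symm]
        linarith
    linarith
  individually_rational b hb i :=
    sub_le_self _ (intervalIntegral.integral_nonneg (hb i) fun r _ => h0 _ i)
  pay_nonneg b hb i := by
    have : ∫ r in (0 : ℝ)..b i, x (Function.update b i r) i ≤ ∫ _ in (0 : ℝ)..b i, x b i :=
      intervalIntegral.integral_mono_on (hb i) (hmono b i).intervalIntegrable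
        intervalIntegrable_const fun r hr => by simpa using hmono b i hr.2
    rw [intervalIntegral.integral_const, smul_eq_mul, sub_zero] at this
    linarith

/-- The envelope payments earn exactly the virtual surplus if nobody wins below the support: then
integrating the allocation from `0` or from the lower end of the support is the same. -/
lemma expectedRevenue_ofMonotone {k : ℕ} (D : Fin k → BoundedValuation)
    (x : (Fin k → ℝ) → Fin k → ℝ) (hx : Measurable x)
    (h0 : ∀ b i, 0 ≤ x b i) (h1 : ∀ b, ∑ i, x b i ≤ 1)
    (hmono : ∀ b i, Monotone fun r => x (Function.update b i r) i)
    (hlo : ∀ b i, b i < (D i).lo → x b i = 0) :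
    (Auction.ofMonotone x hx h0 h1 hmono).expectedRevenue (fun i => (D i).measure) =
      ENNReal.ofReal (∫ v, virtualSurplus D v (x v) ∂(Measure.pi fun i => (D i).measure)) := by
  have hx1 : ∀ b i, x b i ≤ 1 := fun b i =>
    (Finset.single_le_sum (fun j _ => h0 b j) (Finset.mem_univ i)).trans (h1 b)
  have key := fun i : Fin k => integral_pi_envelope_payment D i
    ((measurable_pi_apply i).comp hx) (fun b _ => h0 b i) (fun b _ => hx1 b i)
  simp only [Function.comp_def] at key
  rw [Auction.expectedRevenue_eq]
  unfold virtualSurplus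
  rw [integral_finsetSum _ fun i _ => (key i).2.1]
  congr 1
  refine Finset.sum_congr rfl fun i _ => ?_
  refine Eq.trans ?_ (key i).2.2
  refine integral_congr_ae (Filter.Eventually.of_forall fun v => ?_)
  have hii : ∀ c d : ℝ, IntervalIntegrable (fun r => x (Function.update v i r) i) volume c d :=
    fun c d => (hmono v i).intervalIntegrable
  have hzero : ∫ r in (0 : ℝ)..(D i).lo, x (Function.update v i r) i = 0 := by
    refine intervalIntegral.integral_zero_ae ?_
    filter_upwards [Measure.ae_ne volume (D i).lo] with r hr hmem
    rw [Set.uIoc_of_le (D i).lo_nonneg] at hmem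
    exact hlo _ _ (by simpa using lt_of_le_of_ne hmem.2 hr)
  have hadd := intervalIntegral.integral_add_adjacent_intervals (hii 0 (D i).lo)
    (hii (D i).lo (v i))
  simp only [Auction.ofMonotone]
  rw [← hadd, hzero, zero_add]

/-! ### The optimal auction and the revenue loss of a strategy -/

section Myerson

variable {k : ℕ} (D : Fin k → BoundedValuation)

/-- The virtual valuation, extended from the support to a monotone function on the line. -/
noncomputable def BoundedValuation.score (D : BoundedValuation) (v : ℝ) : ℝ :=
  D.virtual (max D.lo (min v D.hi))

lemma BoundedValuation.score_eq (D : BoundedValuation) {v : ℝ} (hv : v ∈ Set.Icc D.lo D.hi) :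
    D.score v = D.virtual v := by
  rw [score, min_eq_left hv.2, max_eq_right hv.1]

lemma BoundedValuation.measurable_score (D : BoundedValuation) : Measurable D.score :=
  D.measurable_virtual.comp (measurable_const.max (measurable_id.min measurable_const))

lemma BoundedValuation.monotone_score (D : BoundedValuation) : Monotone D.score := by
  intro r s h
  have hm : ∀ v, max D.lo (min v D.hi) ∈ Set.Icc D.lo D.hi := fun v =>
    ⟨le_max_left _ _, max_le D.lo_lt_hi.le (min_le_right _ _)⟩
  exact D.virtual_monotoneOn (hm r) (hm s) (max_le_max le_rfl (min_le_min h le_rfl))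

/-- Bidder `i` wins at the bids `b` if the score of `i` is nonnegative and maximal; among several
such bidders the one with the least index wins. -/
def Wins (b : Fin k → ℝ) (i : Fin k) : Prop :=
  (D i).lo ≤ b i ∧ 0 ≤ (D i).score (b i) ∧ (∀ j, (D j).score (b j) ≤ (D i).score (b i)) ∧
    ∀ j, j < i → (D j).score (b j) < (D i).score (b i)

open Classical in
/-- The allocation rule of Myerson's auction. -/
noncomputable def optAlloc (b : Fin k → ℝ) (i : Fin k) : ℝ := if Wins D b i then 1 else 0

lemma Wins.eq {b : Fin k → ℝ} {i j : Fin k} (hi : Wins D b i) (hj : Wins D b j) : i = j := by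
  rcases lt_trichotomy i j with h | h | h
  · exact absurd (hi.2.2.1 j) (not_le.2 (hj.2.2.2 i h))
  · exact h
  · exact absurd (hj.2.2.1 i) (not_le.2 (hi.2.2.2 j h))

lemma optAlloc_nonneg (b : Fin k → ℝ) (i : Fin k) : 0 ≤ optAlloc D b i := by
  unfold optAlloc; split_ifs <;> simp

lemma optAlloc_of_wins {b : Fin k → ℝ} {i : Fin k} (hi : Wins D b i) :
    optAlloc D b = Pi.single i 1 := by
  ext j
  unfold optAlloc
  by_cases hj : j = i
  · subst hj; simp [hi]
  · rw [if_neg fun h => hj (h.eq D hi), Pi.single_eq_of_ne hj]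

lemma sum_optAlloc_le_one (b : Fin k → ℝ) : ∑ i, optAlloc D b i ≤ 1 := by
  by_cases h : ∃ i, Wins D b i
  · obtain ⟨i, hi⟩ := h
    rw [optAlloc_of_wins D hi]; simp
  · push Not at h
    simp [optAlloc, h]

lemma measurable_optAlloc : Measurable (optAlloc D) := by
  refine measurable_pi_lambda _ fun i => Measurable.ite ?_ measurable_const measurable_const
  have hs : ∀ j, Measurable fun b : Fin k → ℝ => (D j).score (b j) := fun j =>
    (D j).measurable_score.comp (measurable_pi_apply j)
  have : {b : Fin k → ℝ | Wins D b i} = {b | (D i).lo ≤ b i} ∩ ({b | 0 ≤ (D i).score (b i)} ∩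
      ((⋂ j, {b | (D j).score (b j) ≤ (D i).score (b i)}) ∩
        ⋂ j, ⋂ _ : j < i, {b | (D j).score (b j) < (D i).score (b i)})) := by
    ext b; simp [Wins]
  rw [this]
  exact (measurableSet_le measurable_const (measurable_pi_apply i)).inter
    ((measurableSet_le measurable_const (hs i)).inter
      ((MeasurableSet.iInter fun j => measurableSet_le (hs j) (hs i)).inter
        (MeasurableSet.iInter fun j => MeasurableSet.iInter fun _ =>
          measurableSet_lt (hs j) (hs i))))

lemma monotone_optAlloc (b : Fin k → ℝ) (i : Fin k) :
    Monotone fun r => optAlloc D (Function.update b i r) i := by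
  intro r s hrs
  simp only [optAlloc]
  by_cases h : Wins D (Function.update b i r) i
  · have hsc := (D i).monotone_score hrs
    have : Wins D (Function.update b i s) i := by
      obtain ⟨h1, h2, h3, h4⟩ := h
      simp only [Function.update_self] at h1 h2 h3 h4
      refine ⟨by simpa using h1.trans hrs, by simpa using h2.trans hsc, fun j => ?_,
        fun j hj => ?_⟩
      · by_cases hji : j = i
        · subst hji; exact le_rfl
        · have := h3 j
          rw [Function.update_of_ne hji] at this
          simpa [hji] using this.trans hsc
      · have := h4 j hj
        rw [Function.update_of_ne hj.ne] at this
        simpa [hj.ne] using this.trans_le hsc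
    rw [if_pos h, if_pos this]
  · rw [if_neg h]; split_ifs <;> simp

/-- Myerson's rule maximizes the virtual surplus pointwise. -/
lemma virtualSurplus_le_optAlloc {v : Fin k → ℝ} (hv : ∀ i, v i ∈ Set.Icc (D i).lo (D i).hi)
    {y : Fin k → ℝ} (h0 : ∀ i, 0 ≤ y i) (h1 : ∑ i, y i ≤ 1) :
    virtualSurplus D v y ≤ virtualSurplus D v (optAlloc D v) := by
  by_cases h : ∃ i, Wins D v i
  · obtain ⟨i, hi⟩ := h
    have hval : virtualSurplus D v (optAlloc D v) = (D i).virtual (v i) := by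
      rw [optAlloc_of_wins D hi, virtualSurplus]
      simp [Pi.single_apply]
    rw [hval]
    obtain ⟨-, h2, h3, -⟩ := hi
    rw [(D i).score_eq (hv i)] at h2 h3
    calc virtualSurplus D v y ≤ ∑ j, (D i).virtual (v i) * y j :=
          Finset.sum_le_sum fun j _ => mul_le_mul_of_nonneg_right
            (by simpa [(D j).score_eq (hv j)] using h3 j) (h0 j)
      _ = (D i).virtual (v i) * ∑ j, y j := by rw [Finset.mul_sum]
      _ ≤ (D i).virtual (v i) := mul_le_of_le_one_right h2 h1
  · have hneg : ∀ j, (D j).virtual (v j) < 0 := by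
      intro j
      -- Otherwise the least bidder of maximal virtual valuation wins.
      by_contra hj
      push Not at hj
      apply h
      obtain ⟨i, -, hi⟩ := Finset.exists_max_image Finset.univ
        (fun i => (D i).virtual (v i)) ⟨j, Finset.mem_univ j⟩
      let T := Finset.univ.filter fun l => (D l).virtual (v l) = (D i).virtual (v i)
      have hT : T.Nonempty := ⟨i, by simp [T]⟩
      have hmin := T.min'_mem hT
      set i₀ := T.min' hT with hi₀
      have heq : (D i₀).virtual (v i₀) = (D i).virtual (v i) := by simpa [T] using hmin
      refine ⟨i₀, (hv i₀).1, ?_, fun l => ?_, fun l hl => ?_⟩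
      · rw [(D i₀).score_eq (hv i₀), heq]
        exact hj.trans (hi j (Finset.mem_univ j))
      · rw [(D i₀).score_eq (hv i₀), heq, (D l).score_eq (hv l)]
        exact hi l (Finset.mem_univ l)
      · rw [(D i₀).score_eq (hv i₀), heq, (D l).score_eq (hv l)]
        refine lt_of_le_of_ne (hi l (Finset.mem_univ l)) fun hEq => ?_
        exact absurd (T.min'_le l (by simpa [T] using hEq)) (not_le.2 hl)
    have hz : virtualSurplus D v (optAlloc D v) = 0 := by
      push Not at h
      simp [virtualSurplus, optAlloc, h]
    rw [hz]
    exact Finset.sum_nonpos fun j _ => mul_nonpos_of_nonpos_of_nonneg (hneg j).le (h0 j)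

/-- The optimal virtual surplus at the valuation profile `v`. -/
noncomputable def maxSurplus (v : Fin k → ℝ) : ℝ := virtualSurplus D v (optAlloc D v)

lemma integrable_maxSurplus :
    Integrable (maxSurplus D) (Measure.pi fun i => (D i).measure) :=
  integrable_virtualSurplus D (measurable_optAlloc D) (fun b _ i => optAlloc_nonneg D b i)
    (fun b _ i => (Finset.single_le_sum (fun j _ => optAlloc_nonneg D b j)
      (Finset.mem_univ i)).trans (sum_optAlloc_le_one D b))

/-- Myerson's auction earns the optimal expected virtual surplus. -/
lemma integral_maxSurplus_le_optimalRevenue :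
    ENNReal.ofReal (∫ v, maxSurplus D v ∂(Measure.pi fun i => (D i).measure)) ≤
      optimalRevenue fun i => (D i).measure := by
  have h := expectedRevenue_ofMonotone D (optAlloc D) (measurable_optAlloc D) (optAlloc_nonneg D)
    (sum_optAlloc_le_one D) (monotone_optAlloc D) (fun b i hb => by
      rw [optAlloc, if_neg fun hw => absurd hw.1 (not_le.2 hb)])
  unfold maxSurplus
  rw [← h]
  exact le_iSup (fun A : Auction k => A.expectedRevenue fun i => (D i).measure) _

/-- The optimal virtual surplus is nonnegative and does not exceed a common bound on the
valuations. -/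
lemma maxSurplus_mem_Icc {v : Fin k → ℝ} (hv : ∀ i, v i ∈ Set.Icc (D i).lo (D i).hi) {B : ℝ}
    (hB : 0 ≤ B) (hD : ∀ i, (D i).hi ≤ B) : maxSurplus D v ∈ Set.Icc 0 B := by
  constructor
  · have := virtualSurplus_le_optAlloc D hv (y := 0) (fun _ => le_rfl) (by simp)
    simpa [maxSurplus, virtualSurplus] using this
  · unfold maxSurplus virtualSurplus
    calc _ ≤ ∑ i, B * optAlloc D v i :=
          Finset.sum_le_sum fun i _ => mul_le_mul_of_nonneg_right
            (((D i).virtual_le (hv i)).trans ((hv i).2.trans (hD i))) (optAlloc_nonneg D v i)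
      _ = B * ∑ i, optAlloc D v i := by rw [Finset.mul_sum]
      _ ≤ B := mul_le_of_le_one_right hB (sum_optAlloc_le_one D v)

lemma measurable_virtualSurplus {Ω : Type*} [MeasurableSpace Ω] {v x : Ω → Fin k → ℝ}
    (hv : Measurable v) (hx : Measurable x) : Measurable fun z => virtualSurplus D (v z) (x z) :=
  Finset.measurable_fun_sum _ fun i _ =>
    ((D i).measurable_virtual.comp ((measurable_pi_apply i).comp hv)).mul
      ((measurable_pi_apply i).comp hx)

/-- The expected revenue of an auction and the expected shortfall of its virtual surplus together
do not exceed the optimal expected virtual surplus. -/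
lemma Auction.expectedRevenue_add_shortfall_le (A : Auction k) :
    A.expectedRevenue (fun i => (D i).measure) +
      ∫⁻ v, ENNReal.ofReal (maxSurplus D v - virtualSurplus D v (A.alloc v))
        ∂(Measure.pi fun i => (D i).measure) ≤
      ENNReal.ofReal (∫ v, maxSurplus D v ∂(Measure.pi fun i => (D i).measure)) := by
  have hi := integrable_virtualSurplus D A.measurable_alloc (fun b hb i => A.alloc_nonneg b hb i)
    (fun b hb i => A.alloc_le_one hb i)
  have hle := A.sum_integral_pay_le D
  have h0 : ∀ᵐ v ∂Measure.pi fun i => (D i).measure,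
      0 ≤ maxSurplus D v - virtualSurplus D v (A.alloc v) := by
    filter_upwards [ae_forall_mem_Icc D] with v hv
    have hv0 : ∀ j, 0 ≤ v j := fun j => (D j).lo_nonneg.trans (hv j).1
    exact sub_nonneg.2 (virtualSurplus_le_optAlloc D hv (A.alloc_nonneg v hv0)
      (A.sum_alloc_le_one v hv0))
  have hpay : 0 ≤ ∑ i, ∫ v, A.pay v i ∂(Measure.pi fun i => (D i).measure) := by
    refine Finset.sum_nonneg fun i _ => integral_nonneg_of_ae ?_
    filter_upwards [ae_forall_mem_Icc D] with v hv
    exact A.pay_nonneg v (fun j => (D j).lo_nonneg.trans (hv j).1) i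
  have hsub := (integrable_maxSurplus D).sub hi
  simp only [Pi.sub_def] at hsub
  rw [A.expectedRevenue_eq D, ← ofReal_integral_eq_lintegral_ofReal hsub h0,
    ← ENNReal.ofReal_add hpay (integral_nonneg_of_ae h0)]
  refine ENNReal.ofReal_le_ofReal ?_
  rw [integral_sub (integrable_maxSurplus D) hi]
  linarith

/-- The shortfall of the virtual surplus of a strategy, as a function of samples and input. -/
noncomputable def AuctionStrategy.shortfall {m : ℕ} (S : AuctionStrategy k m)
    (z : (Fin m → Fin k → ℝ) × (Fin k → ℝ)) : ℝ :=
  maxSurplus D z.2 - virtualSurplus D z.2 ((S.auction z.1).alloc z.2)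

lemma AuctionStrategy.measurable_shortfall {m : ℕ} (S : AuctionStrategy k m) :
    Measurable (S.shortfall D) :=
  (measurable_virtualSurplus D measurable_snd
    ((measurable_optAlloc D).comp measurable_snd)).sub
    (measurable_virtualSurplus D measurable_snd S.measurable_alloc)

lemma AuctionStrategy.expectedRevenue_add_shortfall_le {m : ℕ} (S : AuctionStrategy k m) :
    S.expectedRevenue (fun i => (D i).measure) +
      ∫⁻ z, ENNReal.ofReal (S.shortfall D z)
        ∂((Measure.pi fun _ : Fin m => Measure.pi fun i => (D i).measure).prod
          (Measure.pi fun i => (D i).measure)) ≤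
      ENNReal.ofReal (∫ v, maxSurplus D v ∂(Measure.pi fun i => (D i).measure)) := by
  set F := Measure.pi fun i => (D i).measure with hF
  have hm : Measurable fun z : (Fin m → Fin k → ℝ) × (Fin k → ℝ) =>
      (S.auction z.1).revenue z.2 := by
    refine Measurable.ennreal_ofReal (Finset.measurable_fun_sum _ fun i _ => ?_)
    exact (measurable_pi_apply i).comp S.measurable_pay
  unfold AuctionStrategy.expectedRevenue
  rw [lintegral_prod _ hm.aemeasurable,
    lintegral_prod _ (S.measurable_shortfall D).ennreal_ofReal.aemeasurable,
    ← lintegral_add_left hm.lintegral_prod_right']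
  calc _ ≤ ∫⁻ _, ENNReal.ofReal (∫ v, maxSurplus D v ∂F)
        ∂(Measure.pi fun _ : Fin m => F) :=
        lintegral_mono fun s => (S.auction s).expectedRevenue_add_shortfall_le D
    _ = _ := by rw [lintegral_const, measure_univ, mul_one]

end Myerson

/-! ### The hard family of valuation distributions -/

/-- The uniform distribution on `[c, c + η]`. -/
noncomputable def uniformValuation (c η : ℝ) (hc : 0 ≤ c) (hη : 0 < η) : BoundedValuation where
  lo := c
  hi := c + η
  density _ := 1 / η
  tail v := (c + η - v) / η
  lo_nonneg := hc
  lo_lt_hi := by linarith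
  measurable_density := measurable_const
  measurable_tail := by fun_prop
  density_pos _ _ := by positivity
  continuousOn_tail := by fun_prop
  hasDerivWithinAt_tail v _ := by
    have := (((hasDerivAt_id v).const_sub (c + η)).div_const η).hasDerivWithinAt (s := Set.Ioi v)
    simpa [neg_div] using this
  tail_lo := by field_simp; ring
  tail_hi := by simp
  virtual_monotoneOn := by
    intro x _ y _ h
    simp only [div_div_div_cancel_right₀ hη.ne', div_one]
    linarith

lemma virtual_uniformValuation (c η : ℝ) (hc : 0 ≤ c) (hη : 0 < η) (v : ℝ) :
    (uniformValuation c η hc hη).virtual v = 2 * v - c - η := by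
  simp only [BoundedValuation.virtual, uniformValuation, div_div_div_cancel_right₀ hη.ne', div_one]
  ring

/-- A tail function `G` on `[0, t]` with `G 0 = 1` and hazard rate `1 / (1 + β v)`, so that the
virtual valuation `(1 - β) v - 1` has slope `1 - β`. -/
structure LinearHazardTail where
  β : ℝ
  t : ℝ
  G : ℝ → ℝ
  β_nonneg : 0 ≤ β
  β_le_one : β ≤ 1
  one_le_t : 1 ≤ t
  measurable_G : Measurable G
  G_zero : G 0 = 1
  G_pos : ∀ v ∈ Set.Icc 0 t, 0 < G v
  hasDerivAt_G : ∀ v ∈ Set.Icc 0 t, HasDerivAt G (-(G v / (1 + β * v))) v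

namespace LinearHazardTail

variable (T : LinearHazardTail)

/-- The reciprocal hazard rate at `t`, the natural length scale at the top of the distribution. -/
noncomputable def s : ℝ := 1 + T.β * T.t

/-- The probability mass above `t`. -/
noncomputable def p : ℝ := T.G T.t

lemma t_pos : 0 < T.t := one_pos.trans_le T.one_le_t

lemma s_pos : 0 < T.s := by
  have := mul_nonneg T.β_nonneg T.t_pos.le
  unfold s; linarith

lemma s_le : T.s ≤ 2 * T.t := by
  have := mul_le_of_le_one_left T.t_pos.le T.β_le_one
  have := T.one_le_t
  unfold s; linarith

lemma p_pos : 0 < T.p := T.G_pos _ ⟨T.t_pos.le, le_rfl⟩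

lemma denom_pos {v : ℝ} (hv : 0 ≤ v) : 0 < 1 + T.β * v := by
  have := mul_nonneg T.β_nonneg hv
  linarith

/-- A virtual valuation with a uniform top piece of width `w` has slope at least `α`: the slopes of
the two pieces are `1 - β` and `2`, and its jump `s - w` at `t` is nonnegative. -/
lemma virtual_increment {w : ℝ} (hws : w ≤ T.s) {φ : ℝ → ℝ}
    (h1 : ∀ v, 0 ≤ v → v < T.t → φ v = (1 - T.β) * v - 1)
    (h2 : ∀ v, T.t ≤ v → φ v = 2 * v - T.t - w) {α : ℝ} (hα : α ≤ 1 - T.β) {x y : ℝ}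
    (hx : 0 ≤ x) (hxy : x ≤ y) : α * (y - x) ≤ φ y - φ x := by
  have hβ := T.β_nonneg
  have hα2 : α ≤ 2 := by linarith
  unfold s at hws
  rcases lt_or_ge x T.t with hxt | hxt
  · rcases lt_or_ge y T.t with hyt | hyt
    · rw [h1 x hx hxt, h1 y (hx.trans hxy) hyt]
      nlinarith [mul_le_mul_of_nonneg_right hα (sub_nonneg.2 hxy)]
    · rw [h1 x hx hxt, h2 y hyt]
      nlinarith [mul_le_mul_of_nonneg_right hα (sub_nonneg.2 hxt.le),
        mul_le_mul_of_nonneg_right hα2 (sub_nonneg.2 hyt)]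
  · rw [h2 x hxt, h2 y (hxt.trans hxy)]
    nlinarith [mul_le_mul_of_nonneg_right hα2 (sub_nonneg.2 hxy)]

/-- The density of the distribution with tail `G` on `[0, t]` and uniform top `[t, t + w]`. -/
noncomputable def dens (w v : ℝ) : ℝ := if v < T.t then T.G v / (1 + T.β * v) else T.p / w

/-- The tail of the distribution with tail `G` on `[0, t]` and uniform top `[t, t + w]`. -/
noncomputable def tl (w v : ℝ) : ℝ := if v < T.t then T.G v else T.p * (T.t + w - v) / w

lemma virtual_low {w v : ℝ} (hv : 0 ≤ v) (hvt : v < T.t) :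
    v - T.tl w v / T.dens w v = (1 - T.β) * v - 1 := by
  have h1 := T.denom_pos hv
  have h2 := T.G_pos v ⟨hv, hvt.le⟩
  rw [tl, dens, if_pos hvt, if_pos hvt, div_div_cancel₀ h2.ne']
  ring

lemma virtual_high {w v : ℝ} (hw : 0 < w) (hvt : T.t ≤ v) :
    v - T.tl w v / T.dens w v = 2 * v - T.t - w := by
  have h2 := T.p_pos
  rw [tl, dens, if_neg hvt.not_gt, if_neg hvt.not_gt]
  field_simp
  ring

/-- The valuation distribution with tail `G` on `[0, t]` whose remaining mass `p` is uniform on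
`[t, t + w]`. -/
noncomputable def valuation (w : ℝ) (hw : 0 < w) (hws : w ≤ T.s) : BoundedValuation where
  lo := 0
  hi := T.t + w
  density := T.dens w
  tail := T.tl w
  lo_nonneg := le_rfl
  lo_lt_hi := by linarith [T.t_pos]
  measurable_density := Measurable.ite measurableSet_Iio
    (T.measurable_G.div (by fun_prop)) measurable_const
  measurable_tail := Measurable.ite measurableSet_Iio T.measurable_G (by fun_prop)
  density_pos v hv := by
    unfold dens
    split_ifs with h
    · exact div_pos (T.G_pos v ⟨hv.1, h.le⟩) (T.denom_pos hv.1)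
    · exact div_pos T.p_pos hw
  continuousOn_tail := by
    rw [← Set.Icc_union_Icc_eq_Icc T.t_pos.le (by linarith : T.t ≤ T.t + w)]
    refine ContinuousOn.union_of_isClosed ?_ ?_ isClosed_Icc isClosed_Icc
    · have hG : ContinuousOn T.G (Set.Icc 0 T.t) := fun v hv =>
        (T.hasDerivAt_G v hv).continuousAt.continuousWithinAt
      refine hG.congr fun v hv => ?_
      rcases hv.2.lt_or_eq with h | h
      · rw [tl, if_pos h]
      · rw [tl, if_neg h.not_lt, h, p]; field_simp; ring
    · have hA : ContinuousOn (fun v => T.p * (T.t + w - v) / w) (Set.Icc T.t (T.t + w)) := by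
        fun_prop
      exact hA.congr fun v hv => by rw [tl, if_neg hv.1.not_gt]
  hasDerivWithinAt_tail v hv := by
    rcases lt_or_ge v T.t with h | h
    · rw [dens, if_pos h]
      refine ((T.hasDerivAt_G v ⟨hv.1.le, h.le⟩).congr_of_eventuallyEq ?_).hasDerivWithinAt
      filter_upwards [Iio_mem_nhds h] with x hx
      exact if_pos (show x < T.t from hx)
    · rw [dens, if_neg h.not_gt]
      have hd : HasDerivAt (fun x => T.p * (T.t + w - x) / w) (-(T.p / w)) v := by
        have := (((hasDerivAt_id v).const_sub (T.t + w)).const_mul T.p).div_const w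
        simpa [neg_div] using this
      refine hd.hasDerivWithinAt.congr (fun x hx => ?_) ?_
      · rw [tl, if_neg (h.trans (le_of_lt hx)).not_gt]
      · rw [tl, if_neg h.not_gt]
  tail_lo := by rw [tl, if_pos T.t_pos, T.G_zero]
  tail_hi := by rw [tl, if_neg (by linarith)]; simp
  virtual_monotoneOn := fun x hx y _ hxy => by
    have := T.virtual_increment hws (φ := fun v => v - T.tl w v / T.dens w v)
      (fun v h0 h => T.virtual_low h0 h) (fun v h => T.virtual_high hw h)
      (α := 0) (by linarith [T.β_le_one]) hx.1 hxy
    simpa using this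

section

variable {w : ℝ} (hw : 0 < w) (hws : w ≤ T.s)

lemma virtual_valuation_low {v : ℝ} (hv : 0 ≤ v) (hvt : v < T.t) :
    (T.valuation w hw hws).virtual v = (1 - T.β) * v - 1 := T.virtual_low hv hvt

lemma virtual_valuation_high {v : ℝ} (hvt : T.t ≤ v) :
    (T.valuation w hw hws).virtual v = 2 * v - T.t - w := T.virtual_high hw hvt

lemma isStronglyRegular_valuation {α : ℝ} (hα : α ≤ 1 - T.β) :
    IsStronglyRegular α (T.valuation w hw hws).measure :=
  (T.valuation w hw hws).isStronglyRegular fun _ hx _ _ hxy =>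
    T.virtual_increment hws (fun _ h0 h => T.virtual_low h0 h)
      (fun _ h => T.virtual_high hw h) hα hx.1 hxy.le

lemma measure_Ici_t :
    (T.valuation w hw hws).measure (Set.Ici T.t) = ENNReal.ofReal T.p := by
  rw [(T.valuation w hw hws).measure_Ici (r := T.t)
    ⟨T.t_pos.le, show T.t ≤ T.t + w by linarith⟩]
  congr 1
  change T.tl w T.t = T.p
  rw [tl, if_neg (lt_irrefl _)]; field_simp; ring

lemma measure_Iio_t :
    (T.valuation w hw hws).measure (Set.Iio T.t) = ENNReal.ofReal (1 - T.p) := by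
  rw [← Set.compl_Ici, prob_compl_eq_one_sub measurableSet_Ici, T.measure_Ici_t hw hws,
    ENNReal.ofReal_sub _ T.p_pos.le, ENNReal.ofReal_one]

/-- Below `t` the distributions do not depend on the width of the top piece. -/
lemma restrict_Iio_eq {w' : ℝ} (hw' : 0 < w') (hws' : w' ≤ T.s) :
    (T.valuation w hw hws).measure.restrict (Set.Iio T.t) =
      (T.valuation w' hw' hws').measure.restrict (Set.Iio T.t) := by
  unfold BoundedValuation.measure
  rw [restrict_withDensity measurableSet_Iio, restrict_withDensity measurableSet_Iio]
  refine withDensity_congr_ae ?_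
  filter_upwards [ae_restrict_mem measurableSet_Iio] with v hv
  have hv : v < T.t := hv
  simp only [valuation, Set.indicator_apply, Set.mem_Icc, dens, if_pos hv]
  have h1 : v ≤ T.t + w := by linarith
  have h2 : v ≤ T.t + w' := by linarith
  simp [h1, h2]

end

/-- On the window the short top piece has three times the density of the long one. -/
lemma restrict_window_eq (h1 : 0 < T.s / 3) (h2 : T.s / 3 ≤ T.s) :
    (T.valuation (T.s / 3) h1 h2).measure.restrict (Set.Icc (T.t + T.s / 20) (T.t + T.s / 5)) =
      (3 : ENNReal) • (T.valuation T.s T.s_pos le_rfl).measure.restrict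
        (Set.Icc (T.t + T.s / 20) (T.t + T.s / 5)) := by
  have hs := T.s_pos
  have ht := T.t_pos
  unfold BoundedValuation.measure
  rw [restrict_withDensity measurableSet_Icc, restrict_withDensity measurableSet_Icc,
    ← withDensity_smul' _ _ (by simp)]
  refine withDensity_congr_ae ?_
  filter_upwards [ae_restrict_mem measurableSet_Icc] with v hv
  obtain ⟨hv1, hv2⟩ := hv
  have hvt : ¬ v < T.t := by linarith
  have hA : v ∈ Set.Icc 0 (T.t + T.s / 3) := ⟨by linarith, by linarith⟩
  have hB : v ∈ Set.Icc 0 (T.t + T.s) := ⟨by linarith, by linarith⟩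
  simp only [valuation, Set.indicator_of_mem hA, Set.indicator_of_mem hB, dens, if_neg hvt,
    Pi.smul_apply, smul_eq_mul]
  rw [← ENNReal.ofReal_ofNat 3, ← ENNReal.ofReal_mul (by norm_num)]
  congr 1
  field_simp

lemma measure_window :
    (T.valuation T.s T.s_pos le_rfl).measure (Set.Icc (T.t + T.s / 20) (T.t + T.s / 5)) =
      ENNReal.ofReal (3 / 20 * T.p) := by
  have hs := T.s_pos
  have ht := T.t_pos
  rw [BoundedValuation.measure_Icc]
  · congr 1
    change T.tl _ _ - T.tl _ _ = _
    rw [tl, tl, if_neg (by linarith), if_neg (by linarith)]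
    field_simp
    ring
  · change (0 : ℝ) ≤ _; linarith
  · linarith
  · change _ ≤ T.t + T.s; linarith

end LinearHazardTail

/-! ### The loss on a pair of indistinguishable profiles -/

/-- Scaling one factor scales the product measure. -/
lemma pi_eq_smul_pi {ι : Type*} [Fintype ι] [DecidableEq ι] {F F' : ι → Measure ℝ}
    [∀ i, SigmaFinite (F i)] [∀ i, SigmaFinite (F' i)] {i : ι} {c : ENNReal}
    (hi : F' i = c • F i) (hj : ∀ j, j ≠ i → F' j = F j) :
    Measure.pi F' = c • Measure.pi F := by
  refine Measure.pi_eq fun s _ => ?_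
  rw [Measure.smul_apply, Measure.pi_pi, smul_eq_mul,
    ← Finset.mul_prod_erase Finset.univ (fun j => F' j (s j)) (Finset.mem_univ i),
    ← Finset.mul_prod_erase Finset.univ (fun j => F j (s j)) (Finset.mem_univ i), hi,
    Measure.smul_apply, smul_eq_mul, mul_assoc]
  congr 2
  exact Finset.prod_congr rfl fun j h => by rw [hj j (Finset.ne_of_mem_erase h)]

namespace LinearHazardTail

variable (T : LinearHazardTail)

/-- The window just above `t` in which the two candidate virtual valuations of a bidder lie on
different sides of that of the reference bidder. -/
noncomputable def window : Set ℝ := Set.Icc (T.t + T.s / 20) (T.t + T.s / 5)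

/-- The reference bidder, whose virtual valuation is within `s / 60` of `t - s / 3`, the virtual
valuation at `t` of a bidder with top piece of width `s / 3`. -/
noncomputable def reference : BoundedValuation :=
  uniformValuation (T.t - T.s / 3) (T.s / 60) (by linarith [T.s_le, T.t_pos])
    (by linarith [T.s_pos])

/-- The two candidate widths of the top piece: long for `true`, short for `false`. -/
noncomputable def width : Bool → ℝ
  | true => T.s
  | false => T.s / 3

lemma width_pos : ∀ c, 0 < T.width c
  | true => T.s_pos
  | false => div_pos T.s_pos three_pos

lemma width_le : ∀ c, T.width c ≤ T.s
  | true => le_rfl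
  | false => div_le_self T.s_pos.le (by norm_num)

/-- The two candidate distributions of the bidders other than the reference bidder. -/
noncomputable def candidate (c : Bool) : BoundedValuation :=
  T.valuation (T.width c) (T.width_pos c) (T.width_le c)

/-- The profile in which bidder `0` is the reference bidder and `b` selects the candidates. -/
noncomputable def profile {k : ℕ} [NeZero k] (b : Fin k → Bool) (i : Fin k) : BoundedValuation :=
  if i = 0 then T.reference else T.candidate (b i)

variable {k : ℕ} [NeZero k]

lemma profile_zero (b : Fin k → Bool) : T.profile b 0 = T.reference := if_pos rfl

lemma profile_of_ne (b : Fin k → Bool) {i : Fin k} (hi : i ≠ 0) :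
    T.profile b i = T.candidate (b i) := if_neg hi

lemma isStronglyRegular_profile {α : ℝ} (hα : α ≤ 1 - T.β) (b : Fin k → Bool) (i : Fin k) :
    IsStronglyRegular α (T.profile b i).measure := by
  by_cases hi : i = 0
  · subst hi
    rw [profile_zero]
    refine BoundedValuation.isStronglyRegular _ fun x _ y _ hxy => ?_
    rw [reference, virtual_uniformValuation, virtual_uniformValuation]
    nlinarith [T.β_nonneg]
  · rw [profile_of_ne T b hi]
    exact T.isStronglyRegular_valuation _ _ hα

lemma profile_hi_le (b : Fin k → Bool) (i : Fin k) : (T.profile b i).hi ≤ T.t + T.s := by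
  have := T.s_pos
  by_cases hi : i = 0
  · subst hi
    rw [profile_zero]
    change T.t - T.s / 3 + T.s / 60 ≤ _
    linarith
  · rw [profile_of_ne T b hi]
    exact add_le_add le_rfl (T.width_le (b i))

/-- The samples in which bidder `i` always stays below `t`. -/
def sampleBox (i : Fin k) : Set (Fin k → ℝ) :=
  Set.univ.pi fun j => if j = i then Set.Iio T.t else Set.univ

/-- The inputs in which bidder `i` is in the window and all other bidders, apart from the reference
bidder, are below `t`. -/
def inputBox (i : Fin k) : Set (Fin k → ℝ) :=
  Set.univ.pi fun j => if j = i then T.window else if j = 0 then Set.univ else Set.Iio T.t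

/-- The event on which nothing distinguishes the two candidates for bidder `i`. -/
def confusion (m : ℕ) (i : Fin k) : Set ((Fin m → Fin k → ℝ) × (Fin k → ℝ)) :=
  (Set.univ.pi fun _ : Fin m => T.sampleBox i) ×ˢ T.inputBox i

/-- The joint distribution of the samples and the input. -/
noncomputable def law (m : ℕ) (b : Fin k → Bool) :
    Measure ((Fin m → Fin k → ℝ) × (Fin k → ℝ)) :=
  (Measure.pi fun _ : Fin m => Measure.pi fun i => (T.profile b i).measure).prod
    (Measure.pi fun i => (T.profile b i).measure)

instance (m : ℕ) (b : Fin k → Bool) : IsProbabilityMeasure (T.law m b) := by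
  unfold law; infer_instance

lemma measurableSet_confusion (m : ℕ) (i : Fin k) : MeasurableSet (T.confusion m i) := by
  refine MeasurableSet.prod (MeasurableSet.univ_pi fun _ => MeasurableSet.univ_pi fun j => ?_)
    (MeasurableSet.univ_pi fun j => ?_)
  · split_ifs
    exacts [measurableSet_Iio, MeasurableSet.univ]
  · split_ifs
    exacts [measurableSet_Icc, MeasurableSet.univ, measurableSet_Iio]

/-- Restricted to the confusion event, the laws of two profiles that differ in bidder `i` are
proportional. -/
lemma law_restrict_confusion (m : ℕ) (b : Fin k → Bool) {i : Fin k} (hi : i ≠ 0) :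
    (T.law m (Function.update b i false)).restrict (T.confusion m i) =
      (3 : ENNReal) • (T.law m (Function.update b i true)).restrict (T.confusion m i) := by
  unfold law confusion sampleBox inputBox
  simp only [← Measure.prod_restrict, Measure.restrict_pi_pi]
  have h1 : ∀ j, j ≠ i → T.profile (Function.update b i false) j =
      T.profile (Function.update b i true) j := by
    intro j hj
    simp only [profile, Function.update_of_ne hj]
  have h2 : ∀ c, T.profile (Function.update b i c) i = T.candidate c := by
    intro c
    rw [profile_of_ne _ _ hi, Function.update_self]
  have hs : (fun j => (T.profile (Function.update b i false) j).measure.restrict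
        (if j = i then Set.Iio T.t else Set.univ)) =
      fun j => (T.profile (Function.update b i true) j).measure.restrict
        (if j = i then Set.Iio T.t else Set.univ) := by
    ext1 j
    by_cases hj : j = i
    · subst hj
      rw [h2, h2, if_pos rfl]
      exact T.restrict_Iio_eq _ _ _ _
    · rw [h1 j hj]
  have hinput : Measure.pi (fun j => (T.profile (Function.update b i false) j).measure.restrict
        (if j = i then T.window else if j = 0 then Set.univ else Set.Iio T.t)) =
      (3 : ENNReal) • Measure.pi fun j => (T.profile (Function.update b i true) j).measure.restrict
        (if j = i then T.window else if j = 0 then Set.univ else Set.Iio T.t) := by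
    refine pi_eq_smul_pi (i := i) ?_ fun j hj => by rw [h1 j hj]
    rw [h2, h2, if_pos rfl]
    exact T.restrict_window_eq (T.width_pos false) (T.width_le false)
  rw [hs, hinput]
  exact Measure.prod_smul_right 3

lemma p_le_one : T.p ≤ 1 := by
  rw [← ENNReal.ofReal_le_one, ← T.measure_Ici_t T.s_pos le_rfl]
  exact prob_le_one

lemma le_law_confusion (m : ℕ) (b : Fin k → Bool) {i : Fin k} (hi : i ≠ 0) :
    ENNReal.ofReal (3 / 20 * T.p * (1 - T.p) ^ (m + k)) ≤
      T.law m (Function.update b i true) (T.confusion m i) := by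
  set b' := Function.update b i true with hb'
  have hp0 := T.p_pos
  have hp1 : 0 ≤ 1 - T.p := sub_nonneg.2 T.p_le_one
  have hp2 : ENNReal.ofReal (1 - T.p) ≤ 1 := ENNReal.ofReal_le_one.2 (by linarith)
  have hlow : ∀ j, j ≠ 0 →
      (T.profile b' j).measure (Set.Iio T.t) = ENNReal.ofReal (1 - T.p) := by
    intro j hj
    rw [profile_of_ne _ _ hj]
    exact T.measure_Iio_t _ _
  have hsample : (Measure.pi fun j => (T.profile b' j).measure) (T.sampleBox i) =
      ENNReal.ofReal (1 - T.p) := by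
    rw [sampleBox, Measure.pi_pi, Finset.prod_eq_single i]
    · rw [if_pos rfl, hlow i hi]
    · intro j _ hj; rw [if_neg hj, measure_univ]
    · simp
  have hinput : ENNReal.ofReal (3 / 20 * T.p) * ENNReal.ofReal (1 - T.p) ^ k ≤
      (Measure.pi fun j => (T.profile b' j).measure) (T.inputBox i) := by
    rw [inputBox, Measure.pi_pi, ← Finset.mul_prod_erase _ _ (Finset.mem_univ i), if_pos rfl,
      profile_of_ne _ _ hi, hb', Function.update_self]
    refine mul_le_mul' (T.measure_window).ge ?_
    calc ENNReal.ofReal (1 - T.p) ^ k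
        ≤ ENNReal.ofReal (1 - T.p) ^ (Finset.univ.erase i).card :=
          pow_le_pow_right_of_le_one' hp2 ((Finset.card_le_univ _).trans (by simp))
      _ = ∏ _j ∈ Finset.univ.erase i, ENNReal.ofReal (1 - T.p) := by rw [Finset.prod_const]
      _ ≤ _ := Finset.prod_le_prod' fun j hj => by
          rw [if_neg (Finset.ne_of_mem_erase hj)]
          by_cases h0 : j = 0
          · rw [if_pos h0, measure_univ]; exact hp2
          · rw [if_neg h0, ← hb', hlow j h0]
  rw [law, confusion, Measure.prod_prod, Measure.pi_pi]
  simp only [hsample, Finset.prod_const, Finset.card_univ, Fintype.card_fin]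
  calc _ = ENNReal.ofReal (1 - T.p) ^ m *
        (ENNReal.ofReal (3 / 20 * T.p) * ENNReal.ofReal (1 - T.p) ^ k) := by
        rw [ENNReal.ofReal_mul (by positivity), ENNReal.ofReal_pow hp1, pow_add]; ring
    _ ≤ _ := by gcongr

/-- If bidder `i` is the only one who may beat the reference bidder, and by the amount `u` in
virtual valuation, then giving the item to `i` with probability `x` has a shortfall of at least
`max u 0 - u x`. -/
lemma le_shortfall {m : ℕ} (S : AuctionStrategy k m) (b : Fin k → Bool) {i : Fin k}
    {z : (Fin m → Fin k → ℝ) × (Fin k → ℝ)}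
    (hz : ∀ j, z.2 j ∈ Set.Icc (T.profile b j).lo (T.profile b j).hi)
    (hlow : ∀ j, j ≠ i → j ≠ 0 → z.2 j < T.t) :
    let x := (S.auction z.1).alloc z.2 i
    let u := (T.profile b i).virtual (z.2 i) - T.reference.virtual (z.2 0)
    0 ≤ x ∧ x ≤ 1 ∧ -(u * x) ≤ S.shortfall (T.profile b) z ∧
      u - u * x ≤ S.shortfall (T.profile b) z := by
  intro x u
  have hs := T.s_pos
  have hst := T.s_le
  have hv0 : ∀ j, 0 ≤ z.2 j := fun j => (T.profile b j).lo_nonneg.trans (hz j).1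
  have hxnn := (S.auction z.1).alloc_nonneg z.2 hv0
  have hxsum := (S.auction z.1).sum_alloc_le_one z.2 hv0
  set y := T.reference.virtual (z.2 0) with hy
  have hylow : T.t - T.s / 3 - T.s / 60 ≤ y := by
    have h0 := (hz 0).1
    rw [profile_zero] at h0
    change T.t - T.s / 3 ≤ z.2 0 at h0
    rw [hy, reference, virtual_uniformValuation]
    linarith
  have hy0 : 0 ≤ y := by linarith
  have hle : ∀ j, j ≠ i → (T.profile b j).virtual (z.2 j) ≤ y := by
    intro j hj
    by_cases h0 : j = 0
    · subst h0; rw [profile_zero]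
    · have hjt := hlow j hj h0
      have hval : (T.profile b j).virtual (z.2 j) = (1 - T.β) * z.2 j - 1 := by
        rw [profile_of_ne _ _ h0]
        exact T.virtual_valuation_low _ _ (hv0 j) hjt
      have h1 := mul_le_mul_of_nonneg_left hjt.le (sub_nonneg.2 T.β_le_one)
      have h2 : T.s = 1 + T.β * T.t := rfl
      rw [hval]
      linarith
  have hmax : ∀ j, (T.profile b j).virtual (z.2 j) ≤ maxSurplus (T.profile b) z.2 := by
    intro j
    have := virtualSurplus_le_optAlloc (T.profile b) hz (y := Pi.single j 1)
      (fun l => by by_cases h : l = j <;> simp [h])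
      (by simp)
    simpa [virtualSurplus, maxSurplus, Pi.single_apply] using this
  have hvs : virtualSurplus (T.profile b) z.2 ((S.auction z.1).alloc z.2) ≤ y + u * x := by
    rw [virtualSurplus, ← Finset.add_sum_erase _ _ (Finset.mem_univ i)]
    rw [← Finset.add_sum_erase _ _ (Finset.mem_univ i)] at hxsum
    have : ∑ j ∈ Finset.univ.erase i,
        (T.profile b j).virtual (z.2 j) * (S.auction z.1).alloc z.2 j ≤
        ∑ j ∈ Finset.univ.erase i, y * (S.auction z.1).alloc z.2 j :=
      Finset.sum_le_sum fun j hj => mul_le_mul_of_nonneg_right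
        (hle j (Finset.ne_of_mem_erase hj)) (hxnn j)
    rw [← Finset.mul_sum] at this
    have h3 := mul_le_mul_of_nonneg_left hxsum hy0
    simp only [u, x]
    linarith
  have hm0 := hmax 0
  have hmi := hmax i
  rw [profile_zero, ← hy] at hm0
  refine ⟨hxnn i, (S.auction z.1).alloc_le_one hv0 i, ?_, ?_⟩
  · unfold AuctionStrategy.shortfall; linarith
  · unfold AuctionStrategy.shortfall; simp only [u] at hvs ⊢; linarith

/-- On the confusion event no allocation suits both candidates. The weight `3` is the ratio of their
densities on the window. -/
lemma shortfall_pair {m : ℕ} (S : AuctionStrategy k m) (b : Fin k → Bool) {i : Fin k}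
    (hi : i ≠ 0) {z : (Fin m → Fin k → ℝ) × (Fin k → ℝ)} (hzc : z ∈ T.confusion m i)
    (hz : ∀ j, z.2 j ∈ Set.Icc (T.profile (Function.update b i true) j).lo
      (T.profile (Function.update b i true) j).hi) :
    T.s / 4 ≤ S.shortfall (T.profile (Function.update b i true)) z +
      3 * S.shortfall (T.profile (Function.update b i false)) z := by
  have hs := T.s_pos
  have ht := T.t_pos
  have hbox : ∀ j, z.2 j ∈ (if j = i then T.window else if j = 0 then Set.univ else Set.Iio T.t) :=
    fun j => hzc.2 j (Set.mem_univ j)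
  have hw : z.2 i ∈ T.window := by simpa using hbox i
  obtain ⟨hw1, hw2⟩ := hw
  have hlow : ∀ j, j ≠ i → j ≠ 0 → z.2 j < T.t := by
    intro j hj h0
    simpa [hj, h0] using hbox j
  have hz' : ∀ j, z.2 j ∈ Set.Icc (T.profile (Function.update b i false) j).lo
      (T.profile (Function.update b i false) j).hi := by
    intro j
    by_cases hj : j = i
    · subst hj
      rw [profile_of_ne _ _ hi, Function.update_self]
      change z.2 j ∈ Set.Icc 0 (T.t + T.s / 3)
      exact ⟨by linarith, by linarith⟩
    · have := hz j
      simpa only [profile, Function.update_of_ne hj] using this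
  obtain ⟨hx0, hx1, h1, h2⟩ := T.le_shortfall S _ hz hlow
  obtain ⟨-, -, h3, h4⟩ := T.le_shortfall S _ hz' hlow
  have hφ1 : (T.profile (Function.update b i true) i).virtual (z.2 i) =
      2 * z.2 i - T.t - T.s := by
    rw [profile_of_ne _ _ hi, Function.update_self]
    exact T.virtual_valuation_high _ _ (by linarith)
  have hφ0 : (T.profile (Function.update b i false) i).virtual (z.2 i) =
      2 * z.2 i - T.t - T.s / 3 := by
    rw [profile_of_ne _ _ hi, Function.update_self]
    exact T.virtual_valuation_high _ _ (by linarith)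
  have hy : T.reference.virtual (z.2 0) = 2 * z.2 0 - (T.t - T.s / 3) - T.s / 60 :=
    virtual_uniformValuation _ _ _ _ _
  have hr := hz 0
  rw [profile_zero] at hr
  obtain ⟨hr1, hr2⟩ := hr
  change T.t - T.s / 3 ≤ _ at hr1
  change _ ≤ T.t - T.s / 3 + T.s / 60 at hr2
  rw [hφ1, hy] at h1
  rw [hφ0, hy] at h4
  set x := (S.auction z.1).alloc z.2 i
  -- With `u` the advantage of `i` under the short candidate, the sum is at least
  -- `3 u (1 - x) + (2 s / 3 - u) x`, an average of two numbers that are at least `s / 4`.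
  have hu1 : T.s / 12 ≤ 2 * z.2 i - T.t - T.s / 3 -
      (2 * z.2 0 - (T.t - T.s / 3) - T.s / 60) := by linarith
  have hu2 : 2 * z.2 i - T.t - T.s / 3 -
      (2 * z.2 0 - (T.t - T.s / 3) - T.s / 60) ≤ 5 * T.s / 12 := by linarith
  nlinarith [mul_le_mul_of_nonneg_right hu1 (sub_nonneg.2 hx1), mul_le_mul_of_nonneg_right hu2 hx0]

/-- The shortfalls of the two candidates on the confusion event cannot both be small. -/
lemma lintegral_shortfall_pair {m : ℕ} (S : AuctionStrategy k m) (b : Fin k → Bool) {i : Fin k}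
    (hi : i ≠ 0) :
    ENNReal.ofReal (T.s / 4 * (3 / 20 * T.p * (1 - T.p) ^ (m + k))) ≤
      (∫⁻ z in T.confusion m i,
        ENNReal.ofReal (S.shortfall (T.profile (Function.update b i true)) z)
          ∂T.law m (Function.update b i true)) +
      ∫⁻ z in T.confusion m i,
        ENNReal.ofReal (S.shortfall (T.profile (Function.update b i false)) z)
          ∂T.law m (Function.update b i false) := by
  have hs := T.s_pos
  have hm1 := (S.measurable_shortfall (T.profile (Function.update b i true))).ennreal_ofReal
  rw [T.law_restrict_confusion m b hi, lintegral_smul_measure, smul_eq_mul,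
    ← lintegral_const_mul _
      (S.measurable_shortfall (T.profile (Function.update b i false))).ennreal_ofReal,
    ← lintegral_add_left hm1]
  calc _ ≤ ENNReal.ofReal (T.s / 4) * T.law m (Function.update b i true) (T.confusion m i) := by
        rw [ENNReal.ofReal_mul (by positivity)]
        gcongr
        exact T.le_law_confusion m b hi
    _ = ∫⁻ _ in T.confusion m i, ENNReal.ofReal (T.s / 4) ∂T.law m (Function.update b i true) := by
        rw [setLIntegral_const]
    _ ≤ _ := by
        refine lintegral_mono_ae ?_
        have hsupp : ∀ᵐ z ∂T.law m (Function.update b i true), ∀ j,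
            z.2 j ∈ Set.Icc (T.profile (Function.update b i true) j).lo
              (T.profile (Function.update b i true) j).hi :=
          Measure.quasiMeasurePreserving_snd.ae
            (ae_forall_mem_Icc (T.profile (Function.update b i true)))
        filter_upwards [ae_restrict_of_ae hsupp,
          ae_restrict_mem (T.measurableSet_confusion m i)] with z hz hzc
        refine (ENNReal.ofReal_le_ofReal (T.shortfall_pair S b hi hzc hz)).trans ?_
        refine ENNReal.ofReal_add_le.trans ?_
        rw [ENNReal.ofReal_mul (by norm_num), ENNReal.ofReal_ofNat]

end LinearHazardTail

/-! ### Averaging over the profiles -/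

namespace LinearHazardTail

variable (T : LinearHazardTail) {k m : ℕ} [NeZero k]

/-- The expected shortfall of a strategy at a profile of the hard family. -/
noncomputable def loss (S : AuctionStrategy k m) (b : Fin k → Bool) : ENNReal :=
  ∫⁻ z, ENNReal.ofReal (S.shortfall (T.profile b) z) ∂T.law m b

/-- The part of the expected shortfall due to the confusion about bidder `i`. -/
noncomputable def confusionLoss (S : AuctionStrategy k m) (b : Fin k → Bool) (i : Fin k) :
    ENNReal :=
  ∫⁻ z in T.confusion m i, ENNReal.ofReal (S.shortfall (T.profile b) z) ∂T.law m b

lemma sum_confusionLoss_le (S : AuctionStrategy k m) (b : Fin k → Bool) :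
    ∑ i ∈ Finset.univ.erase (0 : Fin k), T.confusionLoss S b i ≤ T.loss S b := by
  have hs := T.s_pos
  have hdisj : Set.PairwiseDisjoint (↑(Finset.univ.erase (0 : Fin k)) : Set (Fin k))
      (T.confusion m) := by
    intro i hi j hj hij
    refine Set.disjoint_left.2 fun z hzi hzj => ?_
    have h1 := hzi.2 i (Set.mem_univ i)
    have h2 := hzj.2 i (Set.mem_univ i)
    have hi0 : i ≠ 0 := Finset.ne_of_mem_erase hi
    simp only [if_true] at h1
    simp only [if_neg hij, if_neg hi0] at h2
    have h3 : T.t + T.s / 20 ≤ z.2 i := h1.1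
    have h4 : z.2 i < T.t := h2
    linarith
  unfold confusionLoss
  rw [← lintegral_biUnion_finset hdisj fun i _ => T.measurableSet_confusion m i]
  exact setLIntegral_le_lintegral _ _

/-- A lower bound for the expected loss on the confusion event, summed over the two candidates of a
bidder. -/
noncomputable def pairLoss (k m : ℕ) : ℝ := T.s / 4 * (3 / 20 * T.p * (1 - T.p) ^ (m + k))

lemma pairLoss_nonneg (k m : ℕ) : 0 ≤ T.pairLoss k m := by
  have := T.s_pos
  have := T.p_pos
  have := sub_nonneg.2 T.p_le_one
  unfold pairLoss; positivity

/-- Switching the candidate of bidder `i`. -/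
def switch (i : Fin k) : Equiv.Perm (Fin k → Bool) :=
  Function.Involutive.toPerm (fun b => Function.update b i (!b i)) fun b => by simp

lemma pairLoss_le (S : AuctionStrategy k m) (b : Fin k → Bool) {i : Fin k} (hi : i ≠ 0) :
    ENNReal.ofReal (T.pairLoss k m) ≤
      T.confusionLoss S b i + T.confusionLoss S (switch i b) i := by
  have h := T.lintegral_shortfall_pair S b hi
  have hsw : switch i b = Function.update b i (!b i) := rfl
  rw [hsw]
  cases hb : b i
  · rw [add_comm, Bool.not_false]
    have : Function.update b i false = b := by rw [← hb, Function.update_eq_self]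
    rw [this] at h
    exact h
  · rw [Bool.not_true]
    have : Function.update b i true = b := by rw [← hb, Function.update_eq_self]
    rw [this] at h
    exact h

/-- Some profile of the hard family causes at least the average loss. -/
lemma exists_lt_loss (S : AuctionStrategy k m) {X : ℝ} (hX0 : 0 ≤ X)
    (hX : 2 * X < (k - 1) * T.pairLoss k m) : ∃ b, ENNReal.ofReal X < T.loss S b := by
  by_contra! hcon
  have hκ := T.pairLoss_nonneg k m
  set N := Fintype.card (Fin k → Bool) with hN
  have hNpos : (0 : ℝ) < N := by exact_mod_cast Fintype.card_pos
  have hk : ((k - 1 : ℕ) : ℝ) = (k : ℝ) - 1 := by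
    rw [Nat.cast_sub (NeZero.one_le), Nat.cast_one]
  have hlow : ∀ i ∈ Finset.univ.erase (0 : Fin k),
      ENNReal.ofReal (N * T.pairLoss k m) ≤ 2 * ∑ b, T.confusionLoss S b i := by
    intro i hi
    calc ENNReal.ofReal (N * T.pairLoss k m)
        = ∑ _b : Fin k → Bool, ENNReal.ofReal (T.pairLoss k m) := by
          rw [Finset.sum_const, Finset.card_univ, ← ENNReal.ofReal_nsmul, nsmul_eq_mul]
      _ ≤ ∑ b, (T.confusionLoss S b i + T.confusionLoss S (switch i b) i) :=
          Finset.sum_le_sum fun b _ => T.pairLoss_le S b (Finset.ne_of_mem_erase hi)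
      _ = 2 * ∑ b, T.confusionLoss S b i := by
          rw [Finset.sum_add_distrib,
            Equiv.sum_comp (switch i) fun b => T.confusionLoss S b i, two_mul]
  have hsum : ENNReal.ofReal (((k - 1 : ℕ) : ℝ) * (N * T.pairLoss k m)) ≤
      ENNReal.ofReal (2 * (N * X)) := by
    calc ENNReal.ofReal (((k - 1 : ℕ) : ℝ) * (N * T.pairLoss k m))
        = ∑ _i ∈ Finset.univ.erase (0 : Fin k), ENNReal.ofReal (N * T.pairLoss k m) := by
          rw [Finset.sum_const, Finset.card_erase_of_mem (Finset.mem_univ _), Finset.card_univ,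
            Fintype.card_fin, ← ENNReal.ofReal_nsmul, nsmul_eq_mul]
      _ ≤ ∑ i ∈ Finset.univ.erase (0 : Fin k), 2 * ∑ b, T.confusionLoss S b i :=
          Finset.sum_le_sum hlow
      _ = 2 * ∑ b, ∑ i ∈ Finset.univ.erase (0 : Fin k), T.confusionLoss S b i := by
          rw [← Finset.mul_sum, Finset.sum_comm]
      _ ≤ 2 * ∑ _b : Fin k → Bool, ENNReal.ofReal X := by
          gcongr with b
          exact (T.sum_confusionLoss_le S b).trans (hcon b)
      _ = ENNReal.ofReal (2 * (N * X)) := by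
          rw [Finset.sum_const, Finset.card_univ, ← ENNReal.ofReal_nsmul, nsmul_eq_mul,
            ENNReal.ofReal_mul (by norm_num : (0 : ℝ) ≤ 2), ENNReal.ofReal_ofNat]
  rw [ENNReal.ofReal_le_ofReal_iff (by positivity), hk] at hsum
  have := mul_lt_mul_of_pos_left hX hNpos
  linarith

/-- The lower bound for a single tail: if `ε` is small compared with the probability of confusion
times the relative length scale `s / (t + s)`, some profile defeats the strategy. -/
theorem exists_expectedRevenue_lt (S : AuctionStrategy k m) {α ε : ℝ} (hα : α ≤ 1 - T.β)
    (hε : 0 ≤ ε) (h : ε * (T.t + T.s) < (k - 1) * (3 / 160 * (T.s * T.p * (1 - T.p) ^ (m + k)))) :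
    ∃ F : Fin k → Measure ℝ, (∀ i, IsStronglyRegular α (F i)) ∧
      S.expectedRevenue F < ENNReal.ofReal (1 - ε) * optimalRevenue F := by
  have hU : 0 < T.t + T.s := add_pos T.t_pos T.s_pos
  obtain ⟨b, hb⟩ := T.exists_lt_loss S (X := ε * (T.t + T.s)) (by positivity)
    (by unfold pairLoss; linarith)
  refine ⟨fun i => (T.profile b i).measure, T.isStronglyRegular_profile hα b, ?_⟩
  have hsf := S.expectedRevenue_add_shortfall_le (T.profile b)
  have hopt := integral_maxSurplus_le_optimalRevenue (T.profile b)
  set V := ∫ v, maxSurplus (T.profile b) v ∂(Measure.pi fun i => (T.profile b i).measure) with hV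
  have hVle : V ≤ T.t + T.s := by
    have : V ≤ ∫ _, (T.t + T.s) ∂(Measure.pi fun i => (T.profile b i).measure) := by
      refine integral_mono_ae (integrable_maxSurplus _) (integrable_const _) ?_
      filter_upwards [ae_forall_mem_Icc (T.profile b)] with v hv
      exact (maxSurplus_mem_Icc (T.profile b) hv hU.le (T.profile_hi_le b)).2
    simpa using this
  set R := S.expectedRevenue fun i => (T.profile b i).measure with hR
  have hRV : R + T.loss S b ≤ ENNReal.ofReal V := hsf
  have hRfin : R ≠ ⊤ := ne_top_of_le_ne_top ENNReal.ofReal_ne_top (le_self_add.trans hRV)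
  have hlt : R + ENNReal.ofReal (ε * (T.t + T.s)) < ENNReal.ofReal V :=
    (ENNReal.add_lt_add_left hRfin hb).trans_le hRV
  have hlt2 : R < ENNReal.ofReal ((1 - ε) * V) := by
    have h1 : R < ENNReal.ofReal V - ENNReal.ofReal (ε * (T.t + T.s)) :=
      lt_tsub_iff_right.2 hlt
    rw [← ENNReal.ofReal_sub _ (by positivity)] at h1
    refine h1.trans_le (ENNReal.ofReal_le_ofReal ?_)
    have := mul_le_mul_of_nonneg_left hVle hε
    linarith
  refine hlt2.trans_le ?_
  have hV0 : 0 ≤ V := by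
    by_contra hneg
    rw [ENNReal.ofReal_of_nonpos (not_le.1 hneg).le] at hlt
    exact not_lt_zero hlt
  rw [ENNReal.ofReal_mul' hV0]
  gcongr

end LinearHazardTail

/-! ### Exponential and power-law tails -/

/-- The exponential tail, of slope `β = 0`, cut at the quantile `1 / M`. -/
noncomputable def expTail (M : ℝ) (hM : 1 ≤ Real.log M) : LinearHazardTail where
  β := 0
  t := Real.log M
  G v := Real.exp (-v)
  β_nonneg := le_rfl
  β_le_one := zero_le_one
  one_le_t := hM
  measurable_G := by fun_prop
  G_zero := by simp
  G_pos _ _ := Real.exp_pos _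
  hasDerivAt_G v _ := by
    have := (Real.hasDerivAt_exp (-v)).comp v (hasDerivAt_neg v)
    simpa [Function.comp_def] using this

/-- The tail `(1 + β v) ^ (-1 / β)`, cut at the quantile `1 / M`. -/
noncomputable def powTail (β M : ℝ) (hβ : 0 < β) (hβ1 : β ≤ 1) (hM : 1 ≤ Real.log M) :
    LinearHazardTail where
  β := β
  t := (Real.exp (β * Real.log M) - 1) / β
  G v := Real.exp (-(Real.log (1 + β * v) / β))
  β_nonneg := hβ.le
  β_le_one := hβ1
  one_le_t := by
    rw [le_div_iff₀ hβ]
    have h1 := Real.add_one_le_exp (β * Real.log M)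
    nlinarith
  measurable_G := by fun_prop
  G_zero := by simp
  G_pos _ _ := Real.exp_pos _
  hasDerivAt_G v hv := by
    have hpos : 0 < 1 + β * v := by
      have := mul_nonneg hβ.le hv.1
      linarith
    have h1 : HasDerivAt (fun v => 1 + β * v) β v := by
      simpa using ((hasDerivAt_id v).const_mul β).const_add 1
    have h2 := ((h1.log hpos.ne').div_const β).neg.exp
    convert h2 using 1
    simp only [Pi.neg_apply]
    field_simp
    rfl

/-- The hypothesis on `ε` in terms of a sample bound `N ≥ m`, for a tail cut at the quantile
`1 / (2 N)`. -/
lemma LinearHazardTail.exists_expectedRevenue_lt_of_card (T : LinearHazardTail) {k m : ℕ}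
    (hk : 2 ≤ k) {N : ℝ} (hmN : (m : ℝ) ≤ N) (hkN : 10 * (k : ℝ) ≤ N) (hp : T.p = 1 / (2 * N))
    (S : AuctionStrategy k m) {α ε : ℝ} (hα : α ≤ 1 - T.β) (hε : 0 ≤ ε)
    (h : ε * (T.t + T.s) * (500 * N) < T.s * k) :
    ∃ F : Fin k → Measure ℝ, (∀ i, IsStronglyRegular α (F i)) ∧
      S.expectedRevenue F < ENNReal.ofReal (1 - ε) * optimalRevenue F := by
  have : NeZero k := ⟨by omega⟩
  have hk2 : (2 : ℝ) ≤ k := by exact_mod_cast hk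
  have hN : 0 < N := by linarith
  have hs := T.s_pos
  refine T.exists_expectedRevenue_lt S hα hε ?_
  -- By Bernoulli's inequality, as `(m + k) p ≤ (N + N / 10) / (2 N)`.
  have hbern : 9 / 20 ≤ (1 - T.p) ^ (m + k) := by
    have h1 := one_add_mul_le_pow (a := -T.p) (by linarith [T.p_le_one]) (m + k)
    have h2 : ((m + k : ℕ) : ℝ) * T.p ≤ 11 / 20 := by
      rw [hp, mul_one_div, div_le_iff₀ (by positivity)]
      push_cast
      linarith
    rw [← sub_eq_add_neg] at h1
    linarith
  have h1 : ε * (T.t + T.s) < T.s * k / (500 * N) := by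
    rwa [lt_div_iff₀ (by positivity)]
  have h2 : (k / 2 : ℝ) * (3 / 160 * (T.s * T.p * (9 / 20))) ≤
      (k - 1) * (3 / 160 * (T.s * T.p * (1 - T.p) ^ (m + k))) := by
    have := T.p_pos
    gcongr <;> linarith
  refine (h1.trans_le ?_).trans_le h2
  rw [hp]
  have : (k / 2 : ℝ) * (3 / 160 * (T.s * (1 / (2 * N)) * (9 / 20))) =
      T.s * k / (500 * N) * (27 / 25.6) := by
    field_simp
    norm_num
  rw [this]
  have h3 : 0 ≤ T.s * k / (500 * N) := by positivity
  linarith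

lemma one_le_log_two_mul {N : ℝ} (hN : 2 ≤ N) : 1 ≤ Real.log (2 * N) := by
  rw [Real.le_log_iff_exp_le (by linarith)]
  linarith [Real.exp_one_lt_d9]

/-- The lower bound from the exponential tail, with length scale `s = 1` at `t = log (2 N)`. -/
lemma exists_expectedRevenue_lt_exp {k m : ℕ} (hk : 2 ≤ k) {N : ℝ} (hmN : (m : ℝ) ≤ N)
    (hkN : 10 * (k : ℝ) ≤ N) (S : AuctionStrategy k m) {α ε : ℝ} (hα : α ≤ 1) (hε : 0 ≤ ε)
    (h : ε * (Real.log (2 * N) + 1) * (500 * N) < k) :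
    ∃ F : Fin k → Measure ℝ, (∀ i, IsStronglyRegular α (F i)) ∧
      S.expectedRevenue F < ENNReal.ofReal (1 - ε) * optimalRevenue F := by
  have hk2 : (2 : ℝ) ≤ k := by exact_mod_cast hk
  have hN : 0 < 2 * N := by linarith
  have hs : (expTail (2 * N) (one_le_log_two_mul (by linarith))).s = 1 := by
    simp [LinearHazardTail.s, expTail]
  refine (expTail (2 * N) (one_le_log_two_mul (by linarith))).exists_expectedRevenue_lt_of_card
    hk hmN hkN ?_ S (by simpa [expTail] using hα) hε ?_
  · simp only [LinearHazardTail.p, expTail]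
    rw [Real.exp_neg, Real.exp_log hN, one_div]
  · rw [hs, one_mul]
    exact h

/-- The lower bound from the power-law tail of slope `β = 1 - α`. -/
lemma exists_expectedRevenue_lt_pow {k m : ℕ} (hk : 2 ≤ k) (hkm : 10 * (k : ℝ) ≤ m)
    (S : AuctionStrategy k m) {α ε : ℝ} (hα0 : 0 ≤ α) (hα : α < 1) (hε : 0 ≤ ε)
    (h : 1000 * (ε * m) < (1 - α) * k) :
    ∃ F : Fin k → Measure ℝ, (∀ i, IsStronglyRegular α (F i)) ∧
      S.expectedRevenue F < ENNReal.ofReal (1 - ε) * optimalRevenue F := by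
  have hk2 : (2 : ℝ) ≤ k := by exact_mod_cast hk
  have hm : (0 : ℝ) < 2 * m := by linarith
  have hβ : 0 < 1 - α := sub_pos.2 hα
  set T := powTail (1 - α) (2 * m) hβ (by linarith) (one_le_log_two_mul (by linarith)) with hT
  have hTβ : T.β = 1 - α := rfl
  have hTs : 1 + (1 - α) * T.t = Real.exp ((1 - α) * Real.log (2 * m)) := by
    rw [hT, powTail]; field_simp; ring
  have hs : T.s = 1 + (1 - α) * T.t := rfl
  refine T.exists_expectedRevenue_lt_of_card hk le_rfl hkm ?_ S (by rw [hTβ]; linarith) hε ?_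
  · have : T.p = Real.exp (-(Real.log (1 + (1 - α) * T.t) / (1 - α))) := rfl
    rw [this, hTs, Real.log_exp, mul_div_cancel_left₀ _ hβ.ne', Real.exp_neg, Real.exp_log hm,
      one_div]
  · -- The relative length scale `s / (t + s)` is at least `(1 - α) / 2`.
    have hspos := T.s_pos
    have h1 : (1 - α) * (T.t + T.s) ≤ 2 * T.s := by
      have := mul_le_of_le_one_left hspos.le (by linarith : 1 - α ≤ 1)
      rw [mul_add]
      linarith
    have h2 := mul_lt_mul_of_pos_left h hspos
    have hεm : 0 ≤ ε * m := by positivity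
    have h3 := mul_le_mul_of_nonneg_left h1 hεm
    refine lt_of_mul_lt_mul_left (a := 1 - α) ?_ hβ.le
    nlinarith

/-! ### The sample bounds -/

/-- The logarithmic loss of the exponential tail is absorbed by one of the two factors `k / m`. -/
lemma exp_sample_bound {k m : ℕ} (hk : 2 ≤ k) (hkm : 10 * (k : ℝ) ≤ m) {ε : ℝ} (hε : 0 < ε)
    (h : (m : ℝ) ≤ ((1 - Real.log 2) / (96 * Real.exp 1 ^ 3 * min 1 ((k : ℝ) / Real.exp 1) *
      Real.log (max (Real.exp 1) (k : ℝ)))) ^ (1 / 2 : ℝ) * ((k : ℝ) / Real.sqrt ε)) :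
    ε * (Real.log (2 * m) + 1) * (500 * m) < k := by
  have hk2 : (2 : ℝ) ≤ k := by exact_mod_cast hk
  have hm : (0 : ℝ) < m := by linarith
  have he1 := Real.exp_one_gt_d9
  have he2 := Real.exp_one_lt_d9
  have hl1 := Real.log_two_gt_d9
  have hl2 := Real.log_two_lt_d9
  set L := Real.log (max (Real.exp 1) (k : ℝ)) with hL
  have hL1 : 1 ≤ L := by
    rw [hL, Real.le_log_iff_exp_le (lt_max_of_lt_left (Real.exp_pos 1))]
    exact le_max_left _ _
  have hkL : Real.log k ≤ L := Real.log_le_log (by linarith) (le_max_right _ _)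
  have hmin : 1 / 2 ≤ min 1 ((k : ℝ) / Real.exp 1) := by
    refine le_min (by norm_num) ?_
    rw [le_div_iff₀ (Real.exp_pos 1)]
    linarith
  have he3 : 20 ≤ Real.exp 1 ^ 3 := by
    calc (20 : ℝ) ≤ 2.718 ^ 3 := by norm_num
      _ ≤ Real.exp 1 ^ 3 := by gcongr; linarith
  set A := (1 - Real.log 2) / (96 * Real.exp 1 ^ 3 * min 1 ((k : ℝ) / Real.exp 1) * L) with hA
  have hA0 : 0 ≤ A := by
    have : 0 < min 1 ((k : ℝ) / Real.exp 1) := by linarith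
    exact div_nonneg (by linarith) (by positivity)
  have hAL : 1000 * (A * L) ≤ 1 := by
    have hden : 960 * L ≤ 96 * Real.exp 1 ^ 3 * min 1 ((k : ℝ) / Real.exp 1) * L := by
      calc 960 * L = 96 * 20 * (1 / 2) * L := by ring
        _ ≤ _ := by gcongr
    have : A ≤ (1 / 2) / (960 * L) := by
      rw [hA]
      exact div_le_div₀ (by norm_num) (by linarith) (by positivity) hden
    have h2 : (1 / 2) / (960 * L) * L = 1 / 1920 := by field_simp; norm_num
    have h3 := mul_le_mul_of_nonneg_right this (by linarith : 0 ≤ L)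
    linarith
  have hsq : ε * m ^ 2 ≤ A * k ^ 2 := by
    rw [← Real.sqrt_eq_rpow] at h
    have hsε := Real.sqrt_pos.2 hε
    rw [mul_div_assoc', le_div_iff₀ hsε] at h
    have h2 := pow_le_pow_left₀ (by positivity) h 2
    rw [mul_pow, mul_pow, Real.sq_sqrt hε.le, Real.sq_sqrt hA0] at h2
    linarith
  have hlog : Real.log (2 * m) ≤ L + 2 / 5 + m / (2 * k) := by
    -- Applying `log x ≤ x - 1` to `m / (2 k)` leaves the constant `2 log 2 - 1 ≤ 2 / 5`.
    have hsplit : 2 * (m : ℝ) = k * (2 ^ 2 * (m / (2 * k))) := by field_simp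
    have hq : 0 < (m : ℝ) / (2 * k) := by positivity
    rw [hsplit, Real.log_mul (by positivity) (by positivity),
      Real.log_mul (by norm_num) (by positivity), Real.log_pow]
    have := Real.log_le_sub_one_of_pos hq
    push_cast
    linarith
  have hr : (k : ℝ) * (Real.log (2 * m) + 1) ≤ 4 / 5 * L * m := by
    have h1 : (k : ℝ) * (Real.log (2 * m) + 1) ≤ k * (L + 7 / 5 + m / (2 * k)) := by
      exact mul_le_mul_of_nonneg_left (by linarith) (by linarith)
    have h2 : (k : ℝ) * (L + 7 / 5 + m / (2 * k)) = k * (L + 7 / 5) + m / 2 := by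
      field_simp
    have h3 : (k : ℝ) * (L + 7 / 5) ≤ m / 10 * (L + 7 / 5) := by gcongr; linarith
    have h4 := mul_le_mul_of_nonneg_right hL1 hm.le
    linarith
  have hl0 : 0 ≤ Real.log (2 * m) + 1 := by
    linarith [one_le_log_two_mul (N := m) (by linarith)]
  refine lt_of_mul_lt_mul_right (a := (m : ℝ)) ?_ hm.le
  calc ε * (Real.log (2 * m) + 1) * (500 * m) * m
      = 500 * (Real.log (2 * m) + 1) * (ε * m ^ 2) := by ring
    _ ≤ 500 * (Real.log (2 * m) + 1) * (A * k ^ 2) := by gcongr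
    _ = 500 * A * k * (k * (Real.log (2 * m) + 1)) := by ring
    _ ≤ 500 * A * k * (4 / 5 * L * m) := by gcongr
    _ = 1000 * (A * L) * (2 / 5 * (k * m)) := by ring
    _ ≤ 1 * (2 / 5 * (k * m)) := by gcongr
    _ < k * m := by
      have : (0 : ℝ) < k * m := by positivity
      linarith

lemma mul_two_rpow_le {α : ℝ} (h0 : 0 ≤ α) (h1 : α ≤ 1) :
    0 ≤ 1 - α * 2 ^ (1 - α) ∧ (1 - α * 2 ^ (1 - α)) * 2 ^ α ≤ 1 - α := by
  have hb1 : (2 : ℝ) ^ (1 - α) ≤ 1 + (1 - α) * 1 := by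
    have := rpow_one_add_le_one_add_mul_self (s := (1 : ℝ)) (by norm_num)
      (by linarith : 0 ≤ 1 - α) (by linarith : 1 - α ≤ 1)
    norm_num at this ⊢
    exact this
  have hb2 : (2 : ℝ) ^ α ≤ 1 + α * 1 := by
    have := rpow_one_add_le_one_add_mul_self (s := (1 : ℝ)) (by norm_num) h0 h1
    norm_num at this ⊢
    exact this
  have hprod : (2 : ℝ) ^ (1 - α) * 2 ^ α = 2 := by
    rw [← Real.rpow_add two_pos]; norm_num
  constructor
  · nlinarith [mul_le_mul_of_nonneg_left hb1 h0, sq_nonneg (1 - α)]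
  · have : (1 - α * 2 ^ (1 - α)) * (2 : ℝ) ^ α = 2 ^ α - α * (2 ^ (1 - α) * 2 ^ α) := by ring
    rw [this, hprod]
    linarith

/-- The bounds for `0 < α < 1` all imply a bound of the order `k / ε`, because
the correction factor `Y` does not exceed `2 m / k`. -/
lemma pow_sample_bound {k m c ε α Y : ℝ} (hk : 0 < k) (hm : 0 < m) (hc : 0 ≤ c) (hε : 0 < ε)
    (hα : 0 < α) (hY : 0 ≤ Y) (hYk : Y * k ≤ 2 * m)
    (h : m ≤ c ^ (1 / (1 + α)) * Y ^ (α / (1 + α)) * (k / ε ^ (1 / (1 + α)))) :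
    ε * m ≤ c * 2 ^ α * k := by
  have hα1 : 0 < 1 + α := by linarith
  have hεr : 0 < ε ^ (1 / (1 + α)) := Real.rpow_pos_of_pos hε _
  rw [mul_div_assoc', le_div_iff₀ hεr] at h
  have hpow := Real.rpow_le_rpow (by positivity) h hα1.le
  rw [Real.mul_rpow hm.le hεr.le, Real.mul_rpow (by positivity) hk.le,
    Real.mul_rpow (by positivity) (by positivity), ← Real.rpow_mul hε.le, ← Real.rpow_mul hc,
    ← Real.rpow_mul hY, one_div_mul_cancel hα1.ne', div_mul_cancel₀ _ hα1.ne', Real.rpow_one,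
    Real.rpow_one, Real.rpow_add hm, Real.rpow_add hk, Real.rpow_one, Real.rpow_one] at hpow
  have hmα : 0 < m ^ α := Real.rpow_pos_of_pos hm _
  have hYα : (Y * k) ^ α ≤ (2 * m) ^ α := Real.rpow_le_rpow (by positivity) hYk hα.le
  rw [Real.mul_rpow hY hk.le, Real.mul_rpow two_pos.le hm.le] at hYα
  refine le_of_mul_le_mul_right (a := m ^ α) ?_ hmα
  calc ε * m * m ^ α = m * m ^ α * ε := by ring
    _ ≤ c * Y ^ α * (k * k ^ α) := hpow
    _ = c * k * (Y ^ α * k ^ α) := by ring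
    _ ≤ c * k * (2 ^ α * m ^ α) := by gcongr
    _ = c * 2 ^ α * k * m ^ α := by ring

theorem mainTheorem2 :
    ∃ (N₀ : ℕ) (ε₀ : ℕ → ℝ), (∀ k, 0 < ε₀ k) ∧
      ∀ (k : ℕ), 2 ≤ k → ∀ (ε : ℝ), 0 < ε → ∀ (α : ℝ) (m : ℕ),
        (ε ≤ ε₀ k ∨ N₀ * k ≤ m) →
        ((α = 1 ∧
            (m : ℝ) ≤ ((1 - Real.log 2) / (96 * Real.exp 1 ^ 3 * min 1 ((k : ℝ) / Real.exp 1) *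
              Real.log (max (Real.exp 1) (k : ℝ)))) ^ (1 / 2 : ℝ) * ((k : ℝ) / Real.sqrt ε)) ∨
          (0 < α ∧ α < 1 ∧ 1 / (k : ℝ) ≤ α ^ (1 / (1 - α)) ∧
            (m : ℝ) ≤ ((1 - α * 2 ^ (1 - α)) / (96 * Real.exp 1 ^ 3)) ^ (1 / (1 + α)) *
              ((k : ℝ) / ε ^ (1 / (1 + α)))) ∨
          (0 < α ∧ α < 1 ∧ 1 < 2 * (m : ℝ) * α ^ (1 / (1 - α)) ∧
            α ^ (1 / (1 - α)) < 1 / (k : ℝ) ∧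
            (m : ℝ) ≤ ((1 - α * 2 ^ (1 - α)) / (96 * Real.exp 1 ^ 3)) ^ (1 / (1 + α)) *
              (1 / ((k : ℝ) * α ^ (1 / (1 - α)))) ^ (α / (1 + α)) *
              ((k : ℝ) / ε ^ (1 / (1 + α)))) ∨
          (0 < α ∧ α < 1 ∧ 2 * (m : ℝ) * α ^ (1 / (1 - α)) ≤ 1 ∧
            (m : ℝ) ≤ (1 - α * 2 ^ (1 - α)) * 2 ^ α / (96 * Real.exp 1 ^ 3) * ((k : ℝ) / ε)) ∨
          (α = 0 ∧ (m : ℝ) ≤ 1 / (96 * Real.exp 1 ^ 3) * ((k : ℝ) / ε))) →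
        ∀ S : AuctionStrategy k m,
          ∃ F : Fin k → Measure ℝ, (∀ i, IsStronglyRegular α (F i)) ∧
            S.expectedRevenue F < ENNReal.ofReal (1 - ε) * optimalRevenue F := by
  have hlog20 : ∀ k : ℕ, 0 ≤ Real.log (2 * (10 * k)) := fun k => by
    have := Real.log_natCast_nonneg (2 * (10 * k))
    push_cast at this
    exact this
  refine ⟨10, fun k => 1 / (10000 * (Real.log (2 * (10 * k)) + 1)), fun k => ?_, ?_⟩
  · have := hlog20 k
    positivity
  intro k hk ε hε α m hsmall hcases S
  have hk2 : (2 : ℝ) ≤ k := by exact_mod_cast hk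
  have hα1 : α ≤ 1 := by
    rcases hcases with h | h | h | h | h
    · exact h.1.le
    · exact h.2.1.le
    · exact h.2.1.le
    · exact h.2.1.le
    · rw [h.1]; exact zero_le_one
  by_cases hkm : 10 * k ≤ m
  · have hkm' : 10 * (k : ℝ) ≤ m := by exact_mod_cast hkm
    have hm : (0 : ℝ) < m := by linarith
    rcases hcases with ⟨rfl, h⟩ | hrest
    · exact exists_expectedRevenue_lt_exp hk le_rfl hkm' S le_rfl hε.le
        (exp_sample_bound hk hkm' hε h)
    have he3 : 20 ≤ Real.exp 1 ^ 3 := by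
      calc (20 : ℝ) ≤ 2.718 ^ 3 := by norm_num
        _ ≤ Real.exp 1 ^ 3 := by gcongr; linarith [Real.exp_one_gt_d9]
    obtain ⟨hα0, hαlt, hb⟩ : 0 ≤ α ∧ α < 1 ∧
        ε * m ≤ (1 - α * 2 ^ (1 - α)) / (96 * Real.exp 1 ^ 3) * 2 ^ α * k := by
      rcases hrest with ⟨h0, h1, -, h⟩ | ⟨h0, h1, hA, -, h⟩ | ⟨h0, h1, -, h⟩ | ⟨rfl, h⟩
      · refine ⟨h0.le, h1, pow_sample_bound (Y := 1) (by linarith) hm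
          (div_nonneg (mul_two_rpow_le h0.le h1.le).1 (by positivity)) hε h0 zero_le_one
          (by linarith) ?_⟩
        rwa [Real.one_rpow, mul_one]
      · have hApos : 0 < α ^ (1 / (1 - α)) := Real.rpow_pos_of_pos h0 _
        refine ⟨h0.le, h1, pow_sample_bound (by linarith) hm
          (div_nonneg (mul_two_rpow_le h0.le h1.le).1 (by positivity)) hε h0 (by positivity)
          ?_ h⟩
        rw [div_mul_eq_mul_div, one_mul, div_mul_cancel_left₀ (by positivity : (k : ℝ) ≠ 0),
          inv_le_iff_one_le_mul₀ hApos]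
        exact hA.le
      · refine ⟨h0.le, h1, ?_⟩
        rw [mul_div_assoc', le_div_iff₀ hε] at h
        calc ε * m = m * ε := mul_comm _ _
          _ ≤ _ := h
          _ = _ := by ring
      · refine ⟨le_rfl, one_pos, ?_⟩
        rw [mul_div_assoc', le_div_iff₀ hε] at h
        simp only [zero_mul, sub_zero, Real.rpow_zero, mul_one]
        linarith
    refine exists_expectedRevenue_lt_pow hk hkm' S hα0 hαlt hε.le ?_
    have h2 := (mul_two_rpow_le hα0 hα1).2
    have hpos : 0 < (1 - α) * k := mul_pos (sub_pos.2 hαlt) (by linarith)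
    calc 1000 * (ε * m)
        ≤ 1000 * ((1 - α * 2 ^ (1 - α)) / (96 * Real.exp 1 ^ 3) * 2 ^ α * k) := by gcongr
      _ = 1000 / (96 * Real.exp 1 ^ 3) * ((1 - α * 2 ^ (1 - α)) * 2 ^ α * k) := by ring
      _ ≤ 1000 / (96 * Real.exp 1 ^ 3) * ((1 - α) * k) := by gcongr
      _ < 1 * ((1 - α) * k) := by
        gcongr
        rw [div_lt_one (by positivity)]
        linarith
      _ = (1 - α) * k := one_mul _
  · -- With few samples the strategy is compared with `10 k` samples.
    push Not at hkm
    have hmle : (m : ℝ) ≤ 10 * k := by exact_mod_cast hkm.le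
    have hεk := hsmall.resolve_right (not_le.2 hkm)
    have hl := hlog20 k
    refine exists_expectedRevenue_lt_exp hk hmle le_rfl S hα1 hε.le ?_
    have h1 : ε * (Real.log (2 * (10 * k)) + 1) ≤ 1 / 10000 := by
      rw [le_div_iff₀ (by positivity)] at hεk
      linarith
    have hk0 : (0 : ℝ) < k := by linarith
    calc ε * (Real.log (2 * (10 * k)) + 1) * (500 * (10 * k))
        ≤ 1 / 10000 * (500 * (10 * k)) := by gcongr
      _ < k := by linarith
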